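/- Matrix-weighted expander decomposition. A $k\times k$ matrix-weighted graph $H=(V,E)$ on $n=|V|$ vertices is a simple undirected graph together with a vector $\phi_{uv}\in\mathbb{R}^k$ for every edge $\{u,v\}\in E$ (the edge has matrix weight $\phi_{uv}\phi_{uv}^T$). Let $D_u=\sum_{v\sim u}\phi_{uv}\phi_{uv}^T$, let $D\in\mathbb{R}^{nk\times nk}$ be the block diagonal matrix with blocks $D_u$, let $b_{uv}\in\mathbb{R}^{nk}$ be the block vector with block $\phi_{uv}$ at $u$, block $-\phi_{uv}$ at $v$ and $0$ elsewhere, let $L=\sum_{\{u,v\}\in E}b_{uv}b_{uv}^T$ and $N=D^{\dagger/2}LD^{\dagger/2}$, where $\dagger$ denotes the pseudoinverse and $D^{\dagger/2}$ is the positive semidefinite square root of $D^\dagger$. Let $\lambda_1\le\dots\le\lambda_{nk}$ be the eigenvalues of $N$, with corresponding orthonormal eigenvectors $f_1,\dots,f_{nk}$. $H$ is a $(\gamma,\zeta,\psi)$-almost regular expander if 1. for every vertex $u$ and every edge $\{u,v\}\in E$ at $u$, $\ \phi_{uv}^TD_u^\dagger\phi_{uv}\le \gamma k/n$, and 2. for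 every edge $\{u,v\}\in E$, $\ (D^{\dagger/2}b_{uv})^T\Big(\sum_{i:\,\lambda_i\in(0,\zeta]}\frac1{\lambda_i}f_if_i^T\Big)D^{\dagger/2}b_{uv}\le \psi k^2/n^2$. For $s:E\to[0,1]$ let $H^s$ be the graph obtained from $H$ by replacing each $\phi_{uv}$ by $s_{uv}\phi_{uv}$ (so that the weight of the edge becomes $s_{uv}^2\phi_{uv}\phi_{uv}^T$, the edge set being kept). Theorem. For every constant $c>0$ there is a function $f:\mathbb{N}\to\mathbb{R}$ with $f(n)=o(n^2)$ as $n\to\infty$ such that for all $n$ and $k$, every $k\times k$ matrix-weighted graph $H=(V,E)$ with $|V|=n$ and $|E|\ge c\,n^2$ admits a scaling $s:E\to[0,1]$ such that 1. the rescaled graph $H^s$ is a $(\gamma,\zeta,\psi)$-almost regular expander with $\gamma=8\log n$, $\zeta=1/\log n$ and $\psi=16k^2\log^3 n$ ($\log$ being the natural logarithm), and 2. the number of edges $\{u,v\}\in E$ with $s_{uv}<1$ is at most $f(n)$. -/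

import Mathlib

open Filter Asymptotics
open scoped Matrix

noncomputable section

/-- The pseudoinverse `A^† = ∑_{λᵢ ≠ 0} λᵢ⁻¹ fᵢ fᵢᵀ` of a real symmetric matrix `A` with spectral
decomposition `A = ∑ λᵢ fᵢ fᵢᵀ`, by the functional calculus of symmetric matrices
(in Lean `0⁻¹ = 0`, so that the kernel of `A` is left alone). -/
def symPinv {ι : Type*} [Fintype ι] [DecidableEq ι] (A : Matrix ι ι ℝ) : Matrix ι ι ℝ :=
  cfc (fun x : ℝ => x⁻¹) A

/-- `A^{†/2} = ∑_{λᵢ > 0} λᵢ^{-1/2} fᵢ fᵢᵀ`, the positive semidefinite square root of `A^†`, for a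
positive semidefinite real matrix `A = ∑ λᵢ fᵢ fᵢᵀ`. -/
def symPinvSqrt {ι : Type*} [Fintype ι] [DecidableEq ι] (A : Matrix ι ι ℝ) : Matrix ι ι ℝ :=
  cfc (fun x : ℝ => (Real.sqrt x)⁻¹) A

/-- A `k × k` matrix-weighted graph on the vertex set `V`: a simple undirected graph together with
a vector `φ_{uv} ∈ ℝ^k` for each edge `{u, v}`, whose matrix weight is `φ_{uv} φ_{uv}ᵀ`.
The values of `φ` at unordered pairs that are not edges play no role. -/
structure MatrixWeightedGraph (V : Type*) (k : ℕ) where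
  /-- the underlying graph -/
  graph : SimpleGraph V
  /-- the vectors that determine the matrix weights -/
  φ : Sym2 V → Fin k → ℝ

namespace MatrixWeightedGraph

variable {V : Type*} {k : ℕ}

/-- The rescaled graph `H^s`: the same edges, with `φ_{uv}` replaced by `s_{uv} φ_{uv}`, that is,
with matrix weights `s_{uv}² φ_{uv} φ_{uv}ᵀ`. -/
def rescale (H : MatrixWeightedGraph V k) (s : Sym2 V → ℝ) : MatrixWeightedGraph V k where
  graph := H.graph
  φ := fun e => s e • H.φ e

/-- The incidence vector `b_{uv} ∈ ℝ^{nk}`: its block at `u` is `φ_{uv}`, its block at `v` is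
`-φ_{uv}`, all others are `0`. The entry `(i, w)` is the `i`-th coordinate of the block at `w`. -/
def incVec [DecidableEq V] (H : MatrixWeightedGraph V k) (u v : V) : Fin k × V → ℝ :=
  fun p => ((if p.2 = u then 1 else 0) - (if p.2 = v then 1 else 0)) * H.φ s(u, v) p.1

theorem incVec_swap [DecidableEq V] (H : MatrixWeightedGraph V k) (u v : V) :
    H.incVec v u = -H.incVec u v := by
  funext p
  simp only [incVec, Pi.neg_apply, Sym2.eq_swap (a := v) (b := u)]
  ring

/-- The rank-one matrix `b_e b_eᵀ` of an unordered pair `e = {u, v}`; it does not depend on the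
orientation of `e`. -/
def edgeMatrix [DecidableEq V] (H : MatrixWeightedGraph V k) (e : Sym2 V) :
    Matrix (Fin k × V) (Fin k × V) ℝ :=
  Sym2.lift ⟨fun u v => Matrix.vecMulVec (H.incVec u v) (H.incVec u v), fun u v => by
    beta_reduce
    rw [H.incVec_swap u v, Matrix.neg_vecMulVec, Matrix.vecMulVec_neg, neg_neg]⟩ e

open Classical in
/-- The generalized degree `D_u = ∑_{v ∼ u} φ_{uv} φ_{uv}ᵀ` of a vertex. -/
def vertexDegree [Fintype V] (H : MatrixWeightedGraph V k) (u : V) : Matrix (Fin k) (Fin k) ℝ :=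
  ∑ v with H.graph.Adj u v, Matrix.vecMulVec (H.φ s(u, v)) (H.φ s(u, v))

/-- The degree matrix `D`, block diagonal with the block `D_u` at `u`. -/
def degreeMatrix [Fintype V] [DecidableEq V] (H : MatrixWeightedGraph V k) :
    Matrix (Fin k × V) (Fin k × V) ℝ :=
  Matrix.blockDiagonal H.vertexDegree

open Classical in
/-- The Laplacian matrix `L = ∑_{e ∈ E} b_e b_eᵀ`, each (undirected) edge being counted once. -/
def laplacian [Fintype V] [DecidableEq V] (H : MatrixWeightedGraph V k) :
    Matrix (Fin k × V) (Fin k × V) ℝ :=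
  ∑ e with e ∈ H.graph.edgeSet, H.edgeMatrix e

/-- The normalized Laplacian matrix `N = D^{†/2} L D^{†/2}`. -/
def normLaplacian [Fintype V] [DecidableEq V] (H : MatrixWeightedGraph V k) :
    Matrix (Fin k × V) (Fin k × V) ℝ :=
  symPinvSqrt H.degreeMatrix * H.laplacian * symPinvSqrt H.degreeMatrix

theorem edgeMatrix_isHermitian [DecidableEq V] (H : MatrixWeightedGraph V k) (e : Sym2 V) :
    (H.edgeMatrix e).IsHermitian := by
  induction e using Sym2.ind with
  | _ u v =>
    ext p q
    simp [edgeMatrix, Matrix.vecMulVec_apply, mul_comm]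

theorem laplacian_isHermitian [Fintype V] [DecidableEq V] (H : MatrixWeightedGraph V k) :
    H.laplacian.IsHermitian :=
  isSelfAdjoint_sum _ fun e _ => H.edgeMatrix_isHermitian e

theorem normLaplacian_isHermitian [Fintype V] [DecidableEq V] (H : MatrixWeightedGraph V k) :
    H.normLaplacian.IsHermitian := by
  have h : (symPinvSqrt H.degreeMatrix)ᴴ = symPinvSqrt H.degreeMatrix :=
    cfc_predicate (fun x : ℝ => (Real.sqrt x)⁻¹) H.degreeMatrix
  have hL : H.laplacianᴴ = H.laplacian := H.laplacian_isHermitian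
  simp only [Matrix.IsHermitian, normLaplacian, Matrix.conjTranspose_mul, h, hL, Matrix.mul_assoc]

/-- The matrix `∑_{i : λᵢ ∈ (0, ζ]} (1 / λᵢ) fᵢ fᵢᵀ`, where `fᵢ` is an orthonormal basis of
eigenvectors of the normalized Laplacian, with eigenvalues `λᵢ`. (The matrix does not depend on the
choice of the basis.) -/
def bottomInv [Fintype V] [DecidableEq V] (H : MatrixWeightedGraph V k) (ζ : ℝ) :
    Matrix (Fin k × V) (Fin k × V) ℝ :=
  ∑ i with H.normLaplacian_isHermitian.eigenvalues i ∈ Set.Ioc 0 ζ,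
    (1 / H.normLaplacian_isHermitian.eigenvalues i) •
      Matrix.vecMulVec (H.normLaplacian_isHermitian.eigenvectorBasis i).ofLp
        (H.normLaplacian_isHermitian.eigenvectorBasis i).ofLp

/-- `γ`-almost regularity: `φ_{uv}ᵀ D_u^† φ_{uv} ≤ γ k / n` for every vertex `u` and every edge
`{u, v}` at `u`, where `n = |V|`. -/
def IsAlmostRegular [Fintype V] (H : MatrixWeightedGraph V k) (γ : ℝ) : Prop :=
  ∀ u v : V, H.graph.Adj u v →
    H.φ s(u, v) ⬝ᵥ (symPinv (H.vertexDegree u) *ᵥ H.φ s(u, v)) ≤ γ * k / Fintype.card V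

/-- The `(ζ, ψ)`-expander condition: for every edge `{u, v}` the normalized incidence vector
`x = D^{†/2} b_{uv}` satisfies `xᵀ (∑_{λᵢ ∈ (0, ζ]} (1 / λᵢ) fᵢ fᵢᵀ) x ≤ ψ k² / n²`. -/
def IsExpander [Fintype V] [DecidableEq V] (H : MatrixWeightedGraph V k) (ζ ψ : ℝ) : Prop :=
  ∀ u v : V, H.graph.Adj u v →
    (symPinvSqrt H.degreeMatrix *ᵥ H.incVec u v) ⬝ᵥ
      (H.bottomInv ζ *ᵥ (symPinvSqrt H.degreeMatrix *ᵥ H.incVec u v)) ≤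
        ψ * (k : ℝ) ^ 2 / (Fintype.card V : ℝ) ^ 2

/-- `(γ, ζ, ψ)`-almost regular expanders. -/
def IsAlmostRegularExpander [Fintype V] [DecidableEq V] (H : MatrixWeightedGraph V k)
    (γ ζ ψ : ℝ) : Prop :=
  H.IsAlmostRegular γ ∧ H.IsExpander ζ ψ

end MatrixWeightedGraph

end

set_option linter.unusedSectionVars false

/-! ### Brouwer's fixed point theorem, by change of variables and polynomial continuation. -/

section Brouwer

open MeasureTheory Metric
open scoped ContDiff

/-! The scaling comes from a fixed point. Write `w = s²` for the edge weights, and give each edge a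
cost `r_e(w)`: its leverage in the degree matrix divided by a threshold `τ₁`, plus a spectral
leverage divided by a threshold `τ₂`. Brouwer's theorem yields weights with `w_e = 1 / max(1,
r_e(w))`. Then `w_e r_e ≤ 1` on every edge, which gives both local bounds, and `w_e r_e = 1` on
every edge with `w_e < 1`, so the number of rescaled edges is at most `∑ w_e r_e`
(`exists_complementary_weights`).

That sum is bounded by traces. The degree part is at most `tr (D⁻¹ D)`, the dimension `nk`. For the
spectral part, the function `1/λ` on `(0, ζ]` is replaced by `(1 - λ)²/λ`, which is comparable to it
for `ζ ≤ 1/4`, and which is summable: over the edges it adds up to at most `tr (1 - N)²`, the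
squared Frobenius norm of the normalized adjacency matrix. In a simple graph each edge contributes
to it twice the product of its leverages at the two ends; since these leverages are at most `τ₁`,
the trace is at most `τ₁ nk` (`IsIncidenceFamily.sum_bottomLeverage_le`). Hence at most `nk/τ₁ + τ₁
nk/τ₂` edges are rescaled, and the thresholds are chosen to make this `O(n² / log n)`.

Pseudoinverses are not continuous in the weights, so the fixed point is taken for `D + εI` and `L +
εI`. No limit `ε → 0` is needed. Among finitely many weights there is a large multiplicative gap at
some scale between `ε` and `1`; the edges below the gap get weight `0` (they had `w_e < 1`, so they
are already counted), and above the gap the regularization and the deleted edges are a small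
relative error (`exists_truncation`). The true leverages are compared with the regularized ones
through the dual description of inverse quadratic forms (`leverage_le_of_relative_error`,
`bottom_le_of_relative_error`), tested at vectors that represent the pseudoinverse forms. -/

theorem bijective_add_smul_of_lipschitz {E : Type*} [NormedAddCommGroup E] [NormedSpace ℝ E]
    [CompleteSpace E] {g : E → E} {K : NNReal} (hg : LipschitzWith K g) {t : ℝ}
    (ht : |t| * K < 1) : Function.Bijective fun x => x + t • g x := by
  have hlip : ∀ y, LipschitzWith (‖t‖₊ * K) fun x => y - t • g x := by
    intro y
    refine LipschitzWith.of_dist_le_mul fun a b => ?_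
    rw [dist_sub_left, dist_smul₀, NNReal.coe_mul, mul_assoc]
    exact mul_le_mul_of_nonneg_left (hg.dist_le_mul a b) (norm_nonneg _)
  have hc : ∀ y, ContractingWith (‖t‖₊ * K) fun x => y - t • g x := fun y =>
    ⟨by rw [← NNReal.coe_lt_coe]; simpa using ht, hlip y⟩
  constructor
  · intro a b hab
    have ha : Function.IsFixedPt (fun x => (a + t • g a) - t • g x) a := by
      simp [Function.IsFixedPt]
    have hb : Function.IsFixedPt (fun x => (a + t • g a) - t • g x) b := by
      change (a + t • g a) - t • g b = b
      have : a + t • g a = b + t • g b := hab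
      rw [this]; simp
    exact (hc _).fixedPoint_unique' ha hb
  · intro y
    refine ⟨(hc y).fixedPoint, ?_⟩
    have h : y - t • g ((hc y).fixedPoint) = (hc y).fixedPoint := (hc y).fixedPoint_isFixedPt
    simp only
    nth_rewrite 1 [← h]
    simp

theorem image_eq_of_bijective_of_eqOn_compl {α : Type*} {F : α → α} {B : Set α}
    (hF : Function.Bijective F) (h : ∀ x ∉ B, F x = x) : F '' B = B := by
  apply Set.Subset.antisymm
  · rintro _ ⟨x, hx, rfl⟩
    by_contra hn
    have := h _ hn
    exact hn ((hF.1 this).symm ▸ hx)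
  · intro y hy
    obtain ⟨x, rfl⟩ := hF.2 y
    by_cases hx : x ∈ B
    · exact ⟨x, hx, rfl⟩
    · rw [h x hx] at hy; exact absurd hy hx

variable {ι : Type*} [Fintype ι]

/-- For small `t` the map `x + t g(x)` is a bijection, by the contraction principle, and it is the
identity off the ball, so it maps the ball onto itself. Its Jacobian is close to the identity, hence
has positive determinant, and the change of variables formula needs no absolute value. -/
theorem integral_comp_add_smul_mul_det {g : (ι → ℝ) → (ι → ℝ)} (hg : ContDiff ℝ 1 g)
    (hgc : HasCompactSupport g) {R : ℝ} (hR : ∀ x ∉ closedBall (0 : ι → ℝ) R, g x = 0) :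
    ∃ t₀ > 0, ∀ t : ℝ, |t| < t₀ → ∀ h : (ι → ℝ) → ℝ,
      ∫ x in closedBall 0 R, h (x + t • g x) *
        (ContinuousLinearMap.id ℝ (ι → ℝ) + t • fderiv ℝ g x).det =
      ∫ x in closedBall 0 R, h x := by
  obtain ⟨K, hK⟩ := ContDiff.lipschitzWith_of_hasCompactSupport hgc hg one_ne_zero
  have hdet : ∀ᶠ A : (ι → ℝ) →L[ℝ] (ι → ℝ) in nhds (ContinuousLinearMap.id ℝ (ι → ℝ)),
      0 < A.det :=
    ContinuousLinearMap.continuous_det.continuousAt.eventually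
      (lt_mem_nhds (by simp [ContinuousLinearMap.det]))
  obtain ⟨r, hr, hball⟩ := Metric.eventually_nhds_iff.1 hdet
  refine ⟨min r 1 / (K + 1), by positivity, fun t ht h => ?_⟩
  have htK : |t| * K < min r 1 := by
    rw [lt_div_iff₀ (by positivity)] at ht
    nlinarith [abs_nonneg t, K.2]
  have hbij := bijective_add_smul_of_lipschitz hK (htK.trans_le (min_le_right _ _))
  have himg := image_eq_of_bijective_of_eqOn_compl (B := closedBall (0 : ι → ℝ) R) hbij
    fun x hx => by simp [hR x hx]
  have hder : ∀ x ∈ closedBall (0 : ι → ℝ) R, HasFDerivWithinAt (fun x => x + t • g x)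
      (ContinuousLinearMap.id ℝ (ι → ℝ) + t • fderiv ℝ g x) (closedBall 0 R) x := fun x _ =>
    ((hasFDerivAt_id x).add
      (((hg.differentiable one_ne_zero) x).hasFDerivAt.const_smul t)).hasFDerivWithinAt
  have := integral_image_eq_integral_abs_det_fderiv_smul volume measurableSet_closedBall hder
    hbij.1.injOn h
  rw [himg] at this
  rw [this]
  refine integral_congr_ae (Filter.Eventually.of_forall fun x => ?_)
  have hpos : 0 < (ContinuousLinearMap.id ℝ (ι → ℝ) + t • fderiv ℝ g x).det := by
    apply hball
    rw [dist_eq_norm, add_sub_cancel_left, norm_smul]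
    refine lt_of_le_of_lt ?_ (htK.trans_le (min_le_left _ _))
    exact mul_le_mul_of_nonneg_left (norm_fderiv_le_of_lipschitz ℝ hK) (abs_nonneg _)
  simp only [abs_of_pos hpos, smul_eq_mul]
  ring

open Polynomial in
theorem exists_polynomial_eval_eq_pow_mul_det (x v : ι → ℝ) (A : (ι → ℝ) →L[ℝ] (ι → ℝ)) (C₀ : ℝ)
    (N : ℕ) : ∃ p : ℝ[X], p.natDegree ≤ 2 * N + Fintype.card ι ∧ ∀ t : ℝ,
      p.eval t = (C₀ - ∑ i, (x + t • v) i ^ 2) ^ N *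
        (ContinuousLinearMap.id ℝ (ι → ℝ) + t • A).det := by
  classical
  set M := LinearMap.toMatrix' (A : (ι → ℝ) →ₗ[ℝ] (ι → ℝ)) with hM
  refine ⟨(C C₀ - ∑ i, (C (x i) + C (v i) * X) ^ 2) ^ N *
    ((X : ℝ[X]) • M.map C + (1 : Matrix ι ι ℝ).map C).det, ?_, fun t => ?_⟩
  · refine natDegree_mul_le.trans (add_le_add ?_ (natDegree_det_X_add_C_le _ _))
    refine natDegree_pow_le.trans ?_
    rw [mul_comm]
    refine Nat.mul_le_mul_right _ ?_
    refine (natDegree_sub_le _ _).trans (max_le ((natDegree_C C₀).le.trans (Nat.zero_le _))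
      (natDegree_sum_le_of_forall_le _ _ fun i _ => ?_))
    refine natDegree_pow_le.trans ?_
    have : (C (x i) + C (v i) * X).natDegree ≤ 1 := by
      rw [add_comm]; exact natDegree_linear_le
    omega
  · rw [eval_mul, eval_pow]
    congr 1
    · rw [eval_sub, eval_C, eval_finsetSum]
      simp [mul_comm t]
    · rw [← coe_evalRingHom, RingHom.map_det, ContinuousLinearMap.det]
      rw [← LinearMap.det_toMatrix']
      congr 1
      ext i j
      simp [hM, LinearMap.toMatrix'_apply, Matrix.one_apply, Pi.single_apply, add_comm]
      split_ifs <;> simp [mul_comm]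

/-- The left side with `t` in place of `1` is a polynomial in `t`, constant for small `t` by the
change of variables, hence constant up to `t = 1`, where `x + g(x)` need not be injective. -/
theorem integral_pow_mul_det_eq {g : (ι → ℝ) → (ι → ℝ)} (hg : ContDiff ℝ 1 g)
    (hgc : HasCompactSupport g) {R : ℝ} (hR : ∀ x ∉ closedBall (0 : ι → ℝ) R, g x = 0)
    (C₀ : ℝ) (N : ℕ) :
    ∫ x in closedBall 0 R, (C₀ - ∑ i, (x + (1 : ℝ) • g x) i ^ 2) ^ N *
        (ContinuousLinearMap.id ℝ (ι → ℝ) + (1 : ℝ) • fderiv ℝ g x).det =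
      ∫ x in closedBall (0 : ι → ℝ) R, (C₀ - ∑ i, x i ^ 2) ^ N := by
  have hcont : ∀ t : ℝ, Continuous fun x => (C₀ - ∑ i, (x + t • g x) i ^ 2) ^ N *
      (ContinuousLinearMap.id ℝ (ι → ℝ) + t • fderiv ℝ g x).det := by
    intro t
    have h1 := hg.continuous
    have h2 : Continuous fun x => ContinuousLinearMap.id ℝ (ι → ℝ) + t • fderiv ℝ g x :=
      continuous_const.add (Continuous.const_smul (hg.continuous_fderiv one_ne_zero) t)
    have h3 := ContinuousLinearMap.continuous_det.comp h2
    have h4 : Continuous fun x => (C₀ - ∑ i, (x + t • g x) i ^ 2) ^ N := by fun_prop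
    exact h4.mul h3
  obtain ⟨t₀, ht₀, hsmall⟩ := integral_comp_add_smul_mul_det hg hgc hR
  -- The integrand has degree at most `d` in `t`, so its value at `1` is a fixed linear combination
  -- of its values at `d + 1` nodes inside `(0, t₀)`. The coefficients do not depend on `x` and sum
  -- to `1`, so interpolation passes through the integral.
  set d := 2 * N + Fintype.card ι
  set s := Finset.range (d + 1)
  let v : ℕ → ℝ := fun j => t₀ / (j + 2)
  have hv : Set.InjOn v s := by
    intro a _ b _ hab
    have h2 : t₀ / ((a : ℝ) + 2) = t₀ / ((b : ℝ) + 2) := hab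
    rw [div_eq_div_iff (by positivity) (by positivity)] at h2
    have := mul_left_cancel₀ ht₀.ne' h2
    exact_mod_cast (add_right_cancel this).symm
  have hvlt : ∀ j, |v j| < t₀ := fun j => by
    have : (1 : ℝ) < j + 2 := by linarith [(Nat.cast_nonneg j : (0 : ℝ) ≤ j)]
    rw [abs_of_pos (by positivity)]
    exact div_lt_self ht₀ this
  have hpoint : ∀ x, (C₀ - ∑ i, (x + (1 : ℝ) • g x) i ^ 2) ^ N *
      (ContinuousLinearMap.id ℝ (ι → ℝ) + (1 : ℝ) • fderiv ℝ g x).det =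
      ∑ j ∈ s, (Lagrange.basis s v j).eval 1 * ((C₀ - ∑ i, (x + v j • g x) i ^ 2) ^ N *
      (ContinuousLinearMap.id ℝ (ι → ℝ) + v j • fderiv ℝ g x).det) := by
    intro x
    obtain ⟨p, hpd, hp⟩ := exists_polynomial_eval_eq_pow_mul_det x (g x) (fderiv ℝ g x) C₀ N
    rw [← hp 1]
    have hdeg : p.degree < s.card := by
      refine (Polynomial.degree_le_of_natDegree_le hpd).trans_lt ?_
      simp only [s, Finset.card_range]
      exact_mod_cast Nat.lt_succ_self _
    conv_lhs => rw [Lagrange.eq_interpolate hv hdeg]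
    simp only [Lagrange.interpolate_apply, Polynomial.eval_finsetSum, Polynomial.eval_mul,
      Polynomial.eval_C, hp]
    exact Finset.sum_congr rfl fun j _ => mul_comm _ _
  have hone : ∑ j ∈ s, (Lagrange.basis s v j).eval 1 = 1 := by
    rw [← Polynomial.eval_finsetSum, Lagrange.sum_basis hv ⟨0, by simp [s]⟩,
      Polynomial.eval_one]
  simp_rw [hpoint]
  rw [integral_finsetSum]
  · simp_rw [integral_const_mul]
    rw [Finset.sum_congr rfl fun j _ => by
      rw [hsmall (v j) (hvlt j) fun y => (C₀ - ∑ i, y i ^ 2) ^ N], ← Finset.sum_mul, hone,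
      one_mul]
  · intro j _
    exact Integrable.const_mul ((hcont (v j)).continuousOn.integrableOn_compact
      (isCompact_closedBall _ _)) _

/-- If `x + g(x)` avoids `0`, then `|x + g(x)|² ≥ δ` on the ball, and the transported integral of
`(C₀ - |y|²)^N` grows at most like `(C₀ - δ)^N`. The untransported one is at least a constant times
`(C₀ - δ/2)^N`, from a small ball about `0`. The two are equal for all `N`, which is absurd for
large `N`. -/
theorem exists_add_eq_zero_of_contDiff {g : (ι → ℝ) → (ι → ℝ)} (hg : ContDiff ℝ 1 g)
    (hgc : HasCompactSupport g) : ∃ x, x + g x = 0 := by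
  by_contra! hne
  obtain ⟨R, hRpos, hR⟩ : ∃ R > 0, ∀ x ∉ closedBall (0 : ι → ℝ) R, g x = 0 := by
    obtain ⟨R, hR⟩ := hgc.isCompact.isBounded.subset_closedBall 0
    refine ⟨max R 1, by positivity, fun x hx => ?_⟩
    by_contra h0
    exact hx (closedBall_subset_closedBall (le_max_left _ _)
      (hR (subset_tsupport _ h0)))
  set B := closedBall (0 : ι → ℝ) R with hB
  have hBc : IsCompact B := isCompact_closedBall _ _
  have hBne : B.Nonempty := ⟨0, by simp [hB, hRpos.le]⟩
  have hgcont := hg.continuous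
  have hsq : Continuous fun x : ι → ℝ => ∑ i, x i ^ 2 := by fun_prop
  have hF : Continuous fun x : ι → ℝ => ∑ i, (x + g x) i ^ 2 :=
    hsq.comp (continuous_id.add hgcont)
  obtain ⟨x₀, -, hx₀⟩ := hBc.exists_isMinOn hBne hF.continuousOn
  set δ := ∑ i, (x₀ + g x₀) i ^ 2 with hδ
  have hδpos : 0 < δ := by
    have hnn : 0 ≤ δ := Finset.sum_nonneg fun i _ => sq_nonneg _
    refine lt_of_le_of_ne hnn fun h0 => hne x₀ ?_
    funext i
    have := (Finset.sum_eq_zero_iff_of_nonneg fun i _ => sq_nonneg ((x₀ + g x₀) i)).1 h0.symm i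
      (Finset.mem_univ i)
    simpa using this
  obtain ⟨x₁, -, hx₁⟩ := hBc.exists_isMaxOn hBne hF.continuousOn
  obtain ⟨x₂, -, hx₂⟩ := hBc.exists_isMaxOn hBne hsq.continuousOn
  -- The added `δ` keeps `C₀ - |y|²` positive on the ball and on its image, so powers are monotone.
  set C₀ := max (∑ i, (x₁ + g x₁) i ^ 2) (∑ i, x₂ i ^ 2) + δ with hC₀
  have hdetc : Continuous fun x : ι → ℝ =>
      (ContinuousLinearMap.id ℝ (ι → ℝ) + (1 : ℝ) • fderiv ℝ g x).det :=
    ContinuousLinearMap.continuous_det.comp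
      (continuous_const.add (Continuous.const_smul (hg.continuous_fderiv one_ne_zero) (1 : ℝ)))
  obtain ⟨x₃, -, hx₃⟩ := hBc.exists_isMaxOn hBne hdetc.abs.continuousOn
  set J := |(ContinuousLinearMap.id ℝ (ι → ℝ) + (1 : ℝ) • fderiv ℝ g x₃).det| with hJ
  have key := integral_pow_mul_det_eq hg hgc hR C₀
  have hFδ : ∀ x ∈ B, δ ≤ ∑ i, (x + g x) i ^ 2 := fun x hx => hx₀ hx
  have hFC : ∀ x ∈ B, ∑ i, (x + g x) i ^ 2 ≤ C₀ - δ := fun x hx => by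
    rw [hC₀, add_sub_cancel_right]; exact (hx₁ hx).trans (le_max_left _ _)
  have hsC : ∀ x ∈ B, ∑ i, x i ^ 2 ≤ C₀ - δ := fun x hx => by
    rw [hC₀, add_sub_cancel_right]; exact (hx₂ hx).trans (le_max_right _ _)
  have hCδ : 2 * δ ≤ C₀ := by
    obtain ⟨x, hx⟩ := hBne
    linarith [hFδ x hx, hFC x hx]
  obtain ⟨ρ, hρ, hρR, hρδ⟩ : ∃ ρ > 0, ρ ≤ R ∧ ∀ x ∈ closedBall (0 : ι → ℝ) ρ,
      ∑ i, x i ^ 2 ≤ δ / 2 := by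
    have : ∀ᶠ x : ι → ℝ in nhds 0, ∑ i, x i ^ 2 < δ / 2 :=
      hsq.continuousAt.eventually (gt_mem_nhds (by simpa using hδpos))
    obtain ⟨r, hr, hr'⟩ := Metric.eventually_nhds_iff_ball.1 this
    refine ⟨min (r / 2) R, by positivity, min_le_right _ _, fun x hx => (hr' x ?_).le⟩
    rw [mem_ball]
    rw [mem_closedBall] at hx
    linarith [min_le_left (r / 2) R]
  set V := volume.real B
  set W := volume.real (closedBall (0 : ι → ℝ) ρ)
  have hW : 0 < W := by
    refine ENNReal.toReal_pos (measure_closedBall_pos _ _ hρ).ne' ?_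
    exact measure_closedBall_lt_top.ne
  have hJ0 : 0 ≤ J := abs_nonneg _
  have hupper : ∀ N : ℕ, ∫ x in B, (C₀ - ∑ i, (x + (1 : ℝ) • g x) i ^ 2) ^ N *
        (ContinuousLinearMap.id ℝ (ι → ℝ) + (1 : ℝ) • fderiv ℝ g x).det ≤
        (C₀ - δ) ^ N * J * V := by
    intro N
    refine (Real.le_norm_self _).trans ?_
    refine norm_setIntegral_le_of_norm_le_const measure_closedBall_lt_top fun x hx => ?_
    rw [norm_mul, norm_pow, one_smul ℝ (g x)]
    have h1 := hFC x hx
    have h2 := hFδ x hx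
    refine mul_le_mul (pow_le_pow_left₀ (norm_nonneg _) ?_ N) (hx₃ hx) (norm_nonneg _)
      (pow_nonneg (by linarith) _)
    rw [Real.norm_eq_abs, abs_of_nonneg (by linarith)]
    linarith
  have hlower : ∀ N : ℕ, (C₀ - δ / 2) ^ N * W ≤ ∫ x in B, (C₀ - ∑ i, x i ^ 2) ^ N := by
    intro N
    have hint : IntegrableOn (fun x : ι → ℝ => (C₀ - ∑ i, x i ^ 2) ^ N) B :=
      ContinuousOn.integrableOn_compact hBc ((continuous_const.sub hsq).pow N).continuousOn
    have hsub : closedBall (0 : ι → ℝ) ρ ⊆ B := closedBall_subset_closedBall hρR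
    calc (C₀ - δ / 2) ^ N * W
        = ∫ _ in closedBall (0 : ι → ℝ) ρ, (C₀ - δ / 2) ^ N := by
          rw [setIntegral_const, smul_eq_mul, mul_comm]
      _ ≤ ∫ x in closedBall (0 : ι → ℝ) ρ, (C₀ - ∑ i, x i ^ 2) ^ N := by
          refine setIntegral_mono_on (integrableOn_const measure_closedBall_lt_top.ne)
            (hint.mono_set hsub) measurableSet_closedBall fun x hx => ?_
          exact pow_le_pow_left₀ (by linarith) (by linarith [hρδ x hx]) N
      _ ≤ _ := by
          refine setIntegral_mono_set hint ?_ (Filter.Eventually.of_forall hsub)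
          refine (ae_restrict_iff' measurableSet_closedBall).2
            (Filter.Eventually.of_forall fun x hx => pow_nonneg ?_ N)
          linarith [hsC x hx]
  have hq0 : 0 ≤ (C₀ - δ) / (C₀ - δ / 2) := div_nonneg (by linarith) (by linarith)
  have hq1 : (C₀ - δ) / (C₀ - δ / 2) < 1 := by
    rw [div_lt_one (by linarith)]; linarith
  have hlim := (tendsto_pow_atTop_nhds_zero_of_lt_one hq0 hq1).mul_const (J * V)
  rw [zero_mul] at hlim
  obtain ⟨N, hN⟩ := (hlim.eventually (gt_mem_nhds hW)).exists
  have h1 := (hlower N).trans ((key N).symm.le.trans (hupper N))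
  have hp : 0 < (C₀ - δ / 2) ^ N := pow_pos (by linarith) N
  rw [div_pow, div_mul_eq_mul_div, div_lt_iff₀ hp] at hN
  nlinarith

/-- **Brouwer's fixed point theorem** for bounded self-maps of `ℝ^ι`. -/
theorem exists_fixedPoint_of_continuous_of_norm_le_one {T : (ι → ℝ) → (ι → ℝ)}
    (hT : Continuous T) (hb : ∀ x, ‖T x‖ ≤ 1) : ∃ x, T x = x := by
  have happrox : ∀ δ : ℝ, 0 < δ → δ ≤ 1 → ∃ x ∈ closedBall (0 : ι → ℝ) 2, dist x (T x) ≤ δ := by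
    intro δ hδ hδ1
    -- The cutoff provides compact support; it equals `1` on the ball of radius `2`, which contains
    -- the fixed point found, because `‖T‖ ≤ 1` and the smoothing error is at most `1`.
    let χ : ContDiffBump (0 : ι → ℝ) := ⟨2, 3, by norm_num, by norm_num⟩
    have hcs : HasCompactSupport fun x => χ x • T x := χ.hasCompactSupport.smul_right
    have hcont : Continuous fun x => χ x • T x := χ.continuous.smul hT
    obtain ⟨g, hg, hgd⟩ :=
      (hcs.uniformContinuous_of_continuous hcont).exists_contDiff_dist_le hδ
    have hsm : ContDiff ℝ 1 fun x => -(χ x • g x) :=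
      (χ.contDiff.smul (hg.of_le (by exact_mod_cast le_top))).neg
    have hsc : HasCompactSupport fun x => -(χ x • g x) := by
      have : HasCompactSupport fun x => χ x • g x := χ.hasCompactSupport.smul_right
      exact this.neg
    obtain ⟨x, hx⟩ := exists_add_eq_zero_of_contDiff hsm hsc
    rw [add_neg_eq_zero] at hx
    have hTx : ∀ y, ‖χ y • T y‖ ≤ 1 := fun y => by
      rw [norm_smul, Real.norm_of_nonneg χ.nonneg]
      exact mul_le_one₀ χ.le_one (norm_nonneg _) (hb y)
    have hgx : ‖g x‖ ≤ 2 := by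
      have h1 := norm_le_norm_add_norm_sub' (g x) (χ x • T x)
      have h2 := hgd x
      rw [dist_eq_norm] at h2
      linarith [hTx x]
    have hx2 : ‖x‖ ≤ 2 := by
      rw [hx, norm_smul, Real.norm_of_nonneg χ.nonneg]
      exact (mul_le_of_le_one_left (norm_nonneg _) χ.le_one).trans hgx
    have hχ : χ x = 1 := χ.one_of_mem_closedBall (by simpa using hx2)
    refine ⟨x, by simpa using hx2, ?_⟩
    have h2 := hgd x
    rw [hχ, one_smul] at hx h2
    rw [hx]
    nth_rewrite 2 [← hx]
    exact h2.le
  obtain ⟨x, -, hx⟩ := (isCompact_closedBall (0 : ι → ℝ) 2).exists_isMinOn ⟨0, by simp⟩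
    (continuous_id.dist hT).continuousOn
  refine ⟨x, (dist_le_zero.1 (le_of_forall_pos_le_add fun δ hδ => ?_)).symm⟩
  obtain ⟨y, hy, hyd⟩ := happrox (min δ 1) (by positivity) (min_le_right _ _)
  have h := hx hy
  simp only [id, Set.mem_ofPred_eq] at h
  linarith [min_le_left δ 1]

end Brouwer

/-! ### Regularized leverage scores, complementary weights and trace bounds. -/

noncomputable section

variable {p E : Type*} [Fintype p]

theorem Matrix.IsHermitian.transpose_eq_self {A : Matrix p p ℝ} (hA : A.IsHermitian) : Aᵀ = A := by
  rw [← Matrix.conjTranspose_eq_transpose_of_trivial]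
  exact hA

theorem Matrix.PosSemidef.dotProduct_mulVec_self_nonneg {A : Matrix p p ℝ} (hA : A.PosSemidef)
    (x : p → ℝ) : 0 ≤ x ⬝ᵥ (A *ᵥ x) := by
  simpa using hA.dotProduct_mulVec_nonneg x

theorem Matrix.PosSemidef.dotProduct_mulVec_comm {A : Matrix p p ℝ} (hA : A.PosSemidef)
    (x y : p → ℝ) : x ⬝ᵥ (A *ᵥ y) = y ⬝ᵥ (A *ᵥ x) := by
  have hT := hA.isHermitian.transpose_eq_self
  rw [Matrix.dotProduct_mulVec, ← Matrix.mulVec_transpose, hT, dotProduct_comm]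

/-- The Cauchy-Schwarz inequality of a positive semidefinite form, in its additive form. -/
theorem Matrix.PosSemidef.two_mul_dotProduct_mulVec_le {A : Matrix p p ℝ} (hA : A.PosSemidef)
    (x y : p → ℝ) {κ : ℝ} (hκ : 0 < κ) :
    2 * (x ⬝ᵥ (A *ᵥ y)) ≤ κ * (x ⬝ᵥ (A *ᵥ x)) + (y ⬝ᵥ (A *ᵥ y)) / κ := by
  have h := hA.dotProduct_mulVec_self_nonneg (κ • x - y)
  simp only [Matrix.mulVec_sub, Matrix.mulVec_smul, sub_dotProduct, dotProduct_sub,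
    smul_dotProduct, dotProduct_smul, smul_eq_mul, hA.dotProduct_mulVec_comm y x] at h
  rw [← sub_nonneg]
  have : κ * (x ⬝ᵥ (A *ᵥ x)) + (y ⬝ᵥ (A *ᵥ y)) / κ - 2 * (x ⬝ᵥ (A *ᵥ y)) =
      (κ * (κ * (x ⬝ᵥ (A *ᵥ x))) - κ * (x ⬝ᵥ (A *ᵥ y)) -
        (κ * (x ⬝ᵥ (A *ᵥ y)) - y ⬝ᵥ (A *ᵥ y))) / κ := by
    field_simp
    ring
  rw [this]
  exact div_nonneg (by linarith) hκ.le

/-- The dual description of the quadratic form of an inverse matrix, one inequality. -/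
theorem Matrix.PosDef.two_mul_dotProduct_sub_le [DecidableEq p] {A : Matrix p p ℝ} (hA : A.PosDef)
    (x c : p → ℝ) : 2 * (x ⬝ᵥ c) - x ⬝ᵥ (A *ᵥ x) ≤ c ⬝ᵥ (A⁻¹ *ᵥ c) := by
  have hc : A *ᵥ (A⁻¹ *ᵥ c) = c := by
    rw [Matrix.mulVec_mulVec, Matrix.mul_nonsing_inv _ ((Matrix.isUnit_iff_isUnit_det _).1 hA.isUnit),
      Matrix.one_mulVec]
  have h := hA.posSemidef.two_mul_dotProduct_mulVec_le x (A⁻¹ *ᵥ c) one_pos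
  rw [hc, one_mul, div_one, dotProduct_comm (A⁻¹ *ᵥ c) c] at h
  linarith

variable [Fintype E]

/-- The matrix `∑ₑ wₑ vₑ vₑᵀ`. -/
def weightedGram (w : E → ℝ) (v : E → p → ℝ) : Matrix p p ℝ :=
  ∑ e, w e • Matrix.vecMulVec (v e) (v e)

theorem weightedGram_posSemidef {w : E → ℝ} (hw : ∀ e, 0 ≤ w e) (v : E → p → ℝ) :
    (weightedGram w v).PosSemidef :=
  Matrix.posSemidef_sum _ fun e _ => by
    have := Matrix.posSemidef_vecMulVec_self_star (v e)
    rw [star_trivial] at this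
    exact this.smul (hw e)

theorem dotProduct_weightedGram_mulVec (w : E → ℝ) (v : E → p → ℝ) (x y : p → ℝ) :
    x ⬝ᵥ (weightedGram w v *ᵥ y) = ∑ e, w e * ((v e ⬝ᵥ x) * (v e ⬝ᵥ y)) := by
  simp only [weightedGram, Matrix.sum_mulVec, dotProduct_sum, Matrix.smul_mulVec,
    dotProduct_smul, Matrix.vecMulVec_mulVec, smul_eq_mul]
  refine Finset.sum_congr rfl fun e _ => ?_
  rw [op_smul_eq_smul, smul_eq_mul, dotProduct_comm x]
  ring

theorem Matrix.trace_mul_vecMulVec (Z : Matrix p p ℝ) (x y : p → ℝ) :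
    (Z * Matrix.vecMulVec x y).trace = y ⬝ᵥ (Z *ᵥ x) := by
  rw [Matrix.mul_vecMulVec, Matrix.trace_vecMulVec, dotProduct_comm]

theorem trace_mul_weightedGram (Z : Matrix p p ℝ) (w : E → ℝ) (v : E → p → ℝ) :
    (Z * weightedGram w v).trace = ∑ e, w e * (v e ⬝ᵥ (Z *ᵥ v e)) := by
  simp only [weightedGram, Finset.mul_sum, Matrix.trace_sum, Matrix.mul_smul, Matrix.trace_smul,
    Matrix.trace_mul_vecMulVec, smul_eq_mul]

theorem continuous_weightedGram (v : E → p → ℝ) : Continuous fun w => weightedGram w v := by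
  unfold weightedGram
  fun_prop

variable [DecidableEq p]

/-- The degree matrix `∑ₑ wₑ (αₑ αₑᵀ + βₑ βₑᵀ) + ε I`. -/
def regDegree (α β : E → p → ℝ) (ε : ℝ) (w : E → ℝ) : Matrix p p ℝ :=
  weightedGram w α + weightedGram w β + ε • 1

/-- The Laplacian matrix `∑ₑ wₑ (αₑ - βₑ) (αₑ - βₑ)ᵀ + ε I`. -/
def regLaplacian (α β : E → p → ℝ) (ε : ℝ) (w : E → ℝ) : Matrix p p ℝ :=
  weightedGram w (α - β) + ε • 1

theorem regDegree_posDef (α β : E → p → ℝ) {ε : ℝ} (hε : 0 < ε) {w : E → ℝ}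
    (hw : ∀ e, 0 ≤ w e) : (regDegree α β ε w).PosDef :=
  Matrix.PosDef.posSemidef_add
    ((weightedGram_posSemidef hw α).add (weightedGram_posSemidef hw β)) (Matrix.PosDef.one.smul hε)

theorem regLaplacian_posDef (α β : E → p → ℝ) {ε : ℝ} (hε : 0 < ε) {w : E → ℝ}
    (hw : ∀ e, 0 ≤ w e) : (regLaplacian α β ε w).PosDef :=
  Matrix.PosDef.posSemidef_add (weightedGram_posSemidef hw _) (Matrix.PosDef.one.smul hε)

/-- The vector `b - L D⁻¹ b`, for the regularized matrices and `b = αₑ - βₑ`. -/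
def edgeResidual (α β : E → p → ℝ) (ε : ℝ) (w : E → ℝ) (e : E) : p → ℝ :=
  (α - β) e - regLaplacian α β ε w *ᵥ ((regDegree α β ε w)⁻¹ *ᵥ (α - β) e)

/-- The sum of the two leverage scores of an edge, without its weight. -/
def degreeLeverage (α β : E → p → ℝ) (ε : ℝ) (w : E → ℝ) (e : E) : ℝ :=
  α e ⬝ᵥ ((regDegree α β ε w)⁻¹ *ᵥ α e) + β e ⬝ᵥ ((regDegree α β ε w)⁻¹ *ᵥ β e)

/-- The quadratic form `(1 - λ)² / λ` of the normalized Laplacian at the normalized incidence vector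
of an edge, without the weight of the edge. -/
def bottomLeverage (α β : E → p → ℝ) (ε : ℝ) (w : E → ℝ) (e : E) : ℝ :=
  edgeResidual α β ε w e ⬝ᵥ ((regLaplacian α β ε w)⁻¹ *ᵥ edgeResidual α β ε w e)

theorem Continuous.matrix_inv_of_posDef {X : Type*} [TopologicalSpace X] {A : X → Matrix p p ℝ}
    (hA : Continuous A) (hpos : ∀ x, (A x).PosDef) : Continuous fun x => (A x)⁻¹ := by
  simp only [Matrix.inv_def, Ring.inverse_eq_inv']
  exact (hA.matrix_det.inv₀ fun x => (hpos x).det_pos.ne').smul hA.matrix_adjugate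

variable (α β : E → p → ℝ) {ε : ℝ}

theorem continuous_degreeLeverage (hε : 0 < ε) (e : E) :
    Continuous fun w : E → ℝ => degreeLeverage α β ε (fun e => max (w e) 0) e := by
  have hw : Continuous fun (w : E → ℝ) e => max (w e) 0 := by fun_prop
  have hD : Continuous fun w : E → ℝ => regDegree α β ε fun e => max (w e) 0 :=
    (((continuous_weightedGram α).comp hw).add ((continuous_weightedGram β).comp hw)).add
      continuous_const
  have hX := hD.matrix_inv_of_posDef fun w => regDegree_posDef α β hε fun e => le_max_right _ _
  unfold degreeLeverage
  exact (continuous_const.dotProduct (hX.matrix_mulVec continuous_const)).add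
    (continuous_const.dotProduct (hX.matrix_mulVec continuous_const))

theorem continuous_bottomLeverage (hε : 0 < ε) (e : E) :
    Continuous fun w : E → ℝ => bottomLeverage α β ε (fun e => max (w e) 0) e := by
  have hw : Continuous fun (w : E → ℝ) e => max (w e) 0 := by fun_prop
  have hD : Continuous fun w : E → ℝ => regDegree α β ε fun e => max (w e) 0 :=
    (((continuous_weightedGram α).comp hw).add ((continuous_weightedGram β).comp hw)).add
      continuous_const
  have hL : Continuous fun w : E → ℝ => regLaplacian α β ε fun e => max (w e) 0 :=
    ((continuous_weightedGram (α - β)).comp hw).add continuous_const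
  have hX := hD.matrix_inv_of_posDef fun w => regDegree_posDef α β hε fun e => le_max_right _ _
  have hY := hL.matrix_inv_of_posDef fun w => regLaplacian_posDef α β hε fun e => le_max_right _ _
  have hc : Continuous fun w : E → ℝ => edgeResidual α β ε (fun e => max (w e) 0) e :=
    continuous_const.sub (hL.matrix_mulVec (hX.matrix_mulVec continuous_const))
  exact hc.dotProduct (hY.matrix_mulVec hc)

theorem degreeLeverage_nonneg (hε : 0 < ε) {w : E → ℝ} (hw : ∀ e, 0 ≤ w e) (e : E) :
    0 ≤ degreeLeverage α β ε w e := by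
  have h := (regDegree_posDef α β hε hw).inv.posSemidef
  exact add_nonneg (h.dotProduct_mulVec_self_nonneg _) (h.dotProduct_mulVec_self_nonneg _)

theorem bottomLeverage_nonneg (hε : 0 < ε) {w : E → ℝ} (hw : ∀ e, 0 ≤ w e) (e : E) :
    0 ≤ bottomLeverage α β ε w e :=
  (regLaplacian_posDef α β hε hw).inv.posSemidef.dotProduct_mulVec_self_nonneg _

/-- A fixed point of `w ↦ 1 / max(1, r(w))`. The positive part extends `r` from nonnegative weights
to all of `ℝ^E`, where Brouwer's theorem is applied; at the fixed point it has no effect, since all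
weights are positive. -/
theorem exists_complementary_weights {r : (E → ℝ) → E → ℝ}
    (hr : ∀ e, Continuous fun w : E → ℝ => r (fun e => max (w e) 0) e) :
    ∃ w : E → ℝ, ∀ e, 0 < w e ∧ w e ≤ 1 ∧ w e * r w e ≤ 1 ∧ (w e < 1 → w e * r w e = 1) := by
  have hpos : ∀ (w : E → ℝ) (e : E), 0 < max 1 (r (fun e => max (w e) 0) e) := fun w e =>
    lt_of_lt_of_le one_pos (le_max_left _ _)
  obtain ⟨w, hw⟩ := exists_fixedPoint_of_continuous_of_norm_le_one
    (T := fun w e => (max 1 (r (fun e => max (w e) 0) e))⁻¹)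
    (continuous_pi fun e => (continuous_const.max (hr e)).inv₀ fun w => (hpos w e).ne')
    fun w => (pi_norm_le_iff_of_nonneg zero_le_one).2 fun e => by
      rw [Real.norm_of_nonneg (inv_nonneg.2 (hpos w e).le)]
      exact inv_le_one_of_one_le₀ (le_max_left _ _)
  have hwe : ∀ e, w e = (max 1 (r (fun e => max (w e) 0) e))⁻¹ := fun e => (congrFun hw e).symm
  have hw0 : ∀ e, 0 < w e := fun e => by rw [hwe e]; exact inv_pos.2 (hpos w e)
  have hmax : (fun e => max (w e) 0) = w := funext fun e => max_eq_left (hw0 e).le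
  rw [hmax] at hwe
  refine ⟨w, fun e => ⟨hw0 e, ?_, ?_, fun hlt => ?_⟩⟩
  · rw [hwe e]; exact inv_le_one_of_one_le₀ (le_max_left _ _)
  · have h1 : w e * max 1 (r w e) = 1 := by
      nth_rewrite 1 [hwe e]
      exact inv_mul_cancel₀ (lt_of_lt_of_le one_pos (le_max_left _ _)).ne'
    rw [← h1]
    exact mul_le_mul_of_nonneg_left (le_max_right _ _) (hw0 e).le
  · have h1 : w e * max 1 (r w e) = 1 := by
      nth_rewrite 1 [hwe e]
      exact inv_mul_cancel₀ (lt_of_lt_of_le one_pos (le_max_left _ _)).ne'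
    rcases le_total (r w e) 1 with h | h
    · rw [max_eq_left h] at h1; linarith
    · rwa [max_eq_right h] at h1

theorem sum_degreeLeverage_le (hε : 0 < ε) {w : E → ℝ} (hw : ∀ e, 0 ≤ w e) :
    ∑ e, w e * degreeLeverage α β ε w e ≤ Fintype.card p := by
  set D := regDegree α β ε w with hD
  have hpos := regDegree_posDef α β hε hw
  have h1 : (D⁻¹ * D).trace = Fintype.card p := by
    rw [Matrix.nonsing_inv_mul _ ((Matrix.isUnit_iff_isUnit_det _).1 hpos.isUnit), Matrix.trace_one]
  have h2 : 0 ≤ (D⁻¹ * (ε • (1 : Matrix p p ℝ))).trace := by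
    rw [Matrix.mul_smul, Matrix.mul_one, Matrix.trace_smul]
    exact mul_nonneg hε.le hpos.inv.posSemidef.trace_nonneg
  have h3 : (D⁻¹ * D).trace = (D⁻¹ * weightedGram w α).trace + (D⁻¹ * weightedGram w β).trace +
      (D⁻¹ * (ε • (1 : Matrix p p ℝ))).trace := by
    nth_rewrite 2 [hD]
    rw [regDegree, Matrix.mul_add, Matrix.mul_add, Matrix.trace_add, Matrix.trace_add]
  simp only [degreeLeverage, mul_add, Finset.sum_add_distrib]
  rw [trace_mul_weightedGram, trace_mul_weightedGram] at h3
  linarith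

/-- Block diagonal matrices commute with the coordinate projection to a block, and the inverse of a
matrix commutes with whatever the matrix commutes with. -/
theorem Matrix.inv_apply_eq_zero_of_block {κ : Type*} {M : Matrix p p ℝ} (hM : IsUnit M.det)
    (blk : p → κ) (h : ∀ i j, blk i ≠ blk j → M i j = 0) {i j : p} (hij : blk i ≠ blk j) :
    M⁻¹ i j = 0 := by
  classical
  let P : Matrix p p ℝ := Matrix.diagonal fun i => if blk i = blk j then 1 else 0
  have hc : M * P = P * M := by
    ext a b
    simp only [P, Matrix.mul_diagonal, Matrix.diagonal_mul]
    by_cases hab : blk a = blk b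
    · rw [hab, mul_comm]
    · simp [h a b hab]
  have hc' : M⁻¹ * P = P * M⁻¹ := by
    calc M⁻¹ * P = M⁻¹ * P * (M * M⁻¹) := by rw [Matrix.mul_nonsing_inv _ hM, Matrix.mul_one]
      _ = M⁻¹ * (P * M) * M⁻¹ := by simp only [Matrix.mul_assoc]
      _ = M⁻¹ * (M * P) * M⁻¹ := by rw [hc]
      _ = M⁻¹ * M * (P * M⁻¹) := by simp only [Matrix.mul_assoc]
      _ = P * M⁻¹ := by rw [Matrix.nonsing_inv_mul _ hM, Matrix.one_mul]
  have := congrFun (congrFun hc' i) j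
  simpa [P, Matrix.mul_diagonal, Matrix.diagonal_mul, hij] using this

/-- The vectors `αₑ`, `βₑ` are supported on the blocks of the two ends of the edges of a simple
graph. -/
structure IsIncidenceFamily {V : Type*} (blk : p → V) (hd tl : E → V) (α β : E → p → ℝ) :
    Prop where
  support_left : ∀ e i, α e i ≠ 0 → blk i = hd e
  support_right : ∀ e i, β e i ≠ 0 → blk i = tl e
  loopless : ∀ e, hd e ≠ tl e
  simple : Function.Injective fun e => s(hd e, tl e)

theorem dotProduct_mulVec_eq_zero_of_block {V : Type*} {blk : p → V} {X : Matrix p p ℝ}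
    (hX : ∀ i j, blk i ≠ blk j → X i j = 0) {x y : p → ℝ} {u v : V}
    (hx : ∀ i, x i ≠ 0 → blk i = u) (hy : ∀ i, y i ≠ 0 → blk i = v) (huv : u ≠ v) :
    x ⬝ᵥ (X *ᵥ y) = 0 := by
  refine Finset.sum_eq_zero fun i _ => ?_
  by_cases hxi : x i = 0
  · simp [hxi]
  refine mul_eq_zero_of_right _ (Finset.sum_eq_zero fun j _ => ?_)
  by_cases hyj : y j = 0
  · simp [hyj]
  change X i j * y j = 0
  rw [hX i j (by rw [hx i hxi, hy j hyj]; exact huv), zero_mul]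

variable {α β} in
theorem IsIncidenceFamily.regDegree_block {V : Type*} {blk : p → V} {hd tl : E → V}
    (h : IsIncidenceFamily blk hd tl α β) (w : E → ℝ) (i j : p) (hij : blk i ≠ blk j) :
    regDegree α β ε w i j = 0 := by
  have hne : i ≠ j := fun h => hij (by rw [h])
  simp only [regDegree, weightedGram, Matrix.add_apply, Matrix.sum_apply, Matrix.smul_apply,
    Matrix.vecMulVec_apply, Matrix.one_apply_ne hne, smul_zero, add_zero]
  rw [Finset.sum_eq_zero, Finset.sum_eq_zero, add_zero]
  · intro e _
    by_cases h1 : β e i = 0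
    · simp [h1]
    by_cases h2 : β e j = 0
    · simp [h2]
    exact absurd ((h.support_right e i h1).trans (h.support_right e j h2).symm) hij
  · intro e _
    by_cases h1 : α e i = 0
    · simp [h1]
    by_cases h2 : α e j = 0
    · simp [h2]
    exact absurd ((h.support_left e i h1).trans (h.support_left e j h2).symm) hij

theorem regDegree_sub_regLaplacian (w : E → ℝ) : regDegree α β ε w - regLaplacian α β ε w =
    ∑ e, w e • (Matrix.vecMulVec (α e) (β e) + Matrix.vecMulVec (β e) (α e)) := by
  simp only [regDegree, regLaplacian, weightedGram, add_sub_add_right_eq_sub,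
    ← Finset.sum_add_distrib, ← Finset.sum_sub_distrib, ← smul_add, ← smul_sub]
  refine Finset.sum_congr rfl fun e _ => ?_
  congr 1
  ext i j
  simp [Matrix.vecMulVec_apply]
  ring

variable {α β} in
-- The Frobenius norm of the normalized adjacency matrix. Since `X` is block diagonal, the product
-- of two edge terms has nonzero trace only when the edges share both ends, and in a simple graph
-- they are then the same edge.
theorem IsIncidenceFamily.trace_sq_eq {V : Type*} {blk : p → V} {hd tl : E → V}
    (h : IsIncidenceFamily blk hd tl α β) {w : E → ℝ} {X : Matrix p p ℝ}
    (hX : ∀ i j, blk i ≠ blk j → X i j = 0) :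
    ((X * ∑ e, w e • (Matrix.vecMulVec (α e) (β e) + Matrix.vecMulVec (β e) (α e))) *
      (X * ∑ e, w e • (Matrix.vecMulVec (α e) (β e) + Matrix.vecMulVec (β e) (α e)))).trace =
      ∑ e, 2 * ((w e * (α e ⬝ᵥ (X *ᵥ α e))) * (w e * (β e ⬝ᵥ (X *ᵥ β e)))) := by
  classical
  have hterm : ∀ a b c d : p → ℝ, ((X * Matrix.vecMulVec a b) * (X * Matrix.vecMulVec c d)).trace =
      (b ⬝ᵥ (X *ᵥ c)) * (d ⬝ᵥ (X *ᵥ a)) := by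
    intro a b c d
    rw [Matrix.mul_vecMulVec, Matrix.mul_vecMulVec, Matrix.vecMulVec_mul_vecMulVec,
      Matrix.trace_vecMulVec, dotProduct_smul, smul_eq_mul, dotProduct_comm d]
  simp only [Finset.mul_sum, Finset.sum_mul, Matrix.trace_sum, Matrix.mul_smul, Matrix.smul_mul,
    Matrix.trace_smul, Matrix.mul_add, Matrix.add_mul, Matrix.trace_add, hterm, smul_eq_mul]
  have hz := fun {x y : p → ℝ} {u v : V} => dotProduct_mulVec_eq_zero_of_block (x := x) (y := y)
    (u := u) (v := v) hX
  refine Finset.sum_congr rfl fun e _ => ?_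
  rw [Finset.sum_eq_single e]
  · rw [hz (h.support_left e) (h.support_right e) (h.loopless e),
      hz (h.support_right e) (h.support_left e) (h.loopless e).symm]
    ring
  · intro e' _ hne
    have hdt : ¬(hd e = tl e' ∧ tl e = hd e') := fun hh => hne (h.simple (by
      simp only [Sym2.eq_iff]; exact Or.inr ⟨hh.2.symm, hh.1.symm⟩))
    have hdd : ¬(hd e = hd e' ∧ tl e = tl e') := fun hh => hne (h.simple (by
      simp only [Sym2.eq_iff]; exact Or.inl ⟨hh.1.symm, hh.2.symm⟩))
    have z1 : (β e ⬝ᵥ (X *ᵥ α e')) * (β e' ⬝ᵥ (X *ᵥ α e)) = 0 := by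
      by_cases h1 : tl e = hd e'
      · have h2 : tl e' ≠ hd e := fun h2 => hdt ⟨h2.symm, h1⟩
        rw [hz (h.support_right e') (h.support_left e) h2, mul_zero]
      · rw [hz (h.support_right e) (h.support_left e') h1, zero_mul]
    have z2 : (α e ⬝ᵥ (X *ᵥ α e')) * (β e' ⬝ᵥ (X *ᵥ β e)) = 0 := by
      by_cases h1 : hd e = hd e'
      · have h2 : tl e' ≠ tl e := fun h2 => hdd ⟨h1, h2.symm⟩
        rw [hz (h.support_right e') (h.support_right e) h2, mul_zero]
      · rw [hz (h.support_left e) (h.support_left e') h1, zero_mul]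
    have z3 : (β e ⬝ᵥ (X *ᵥ β e')) * (α e' ⬝ᵥ (X *ᵥ α e)) = 0 := by
      by_cases h1 : hd e' = hd e
      · have h2 : tl e ≠ tl e' := fun h2 => hdd ⟨h1.symm, h2⟩
        rw [hz (h.support_right e) (h.support_right e') h2, zero_mul]
      · rw [hz (h.support_left e') (h.support_left e) h1, mul_zero]
    have z4 : (α e ⬝ᵥ (X *ᵥ β e')) * (α e' ⬝ᵥ (X *ᵥ β e)) = 0 := by
      by_cases h1 : hd e = tl e'
      · have h2 : hd e' ≠ tl e := fun h2 => hdt ⟨h1, h2.symm⟩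
        rw [hz (h.support_left e') (h.support_right e) h2, mul_zero]
      · rw [hz (h.support_left e) (h.support_right e') h1, zero_mul]
    linear_combination (w e * w e') * (z1 + z2 + z3 + z4)
  · intro hn; exact absurd (Finset.mem_univ e) hn

/-- With `B = 1 - L D⁻¹`, the sum is the trace of `Bᵀ L⁻¹ B` against `L - εI`. Dropping `-εI` only
increases it, and `Bᵀ L⁻¹ B L = (1 - D⁻¹ L)²`. -/
theorem sum_bottomLeverage_le_trace (hε : 0 < ε) {w : E → ℝ} (hw : ∀ e, 0 ≤ w e) :
    ∑ e, w e * bottomLeverage α β ε w e ≤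
      (((regDegree α β ε w)⁻¹ * (regDegree α β ε w - regLaplacian α β ε w)) *
      ((regDegree α β ε w)⁻¹ * (regDegree α β ε w - regLaplacian α β ε w))).trace := by
  have hDpos := regDegree_posDef α β hε hw
  have hLpos := regLaplacian_posDef α β hε hw
  have hres : ∀ e, edgeResidual α β ε w e = (1 - regLaplacian α β ε w * (regDegree α β ε w)⁻¹) *ᵥ
      (α - β) e := fun e => by
    rw [edgeResidual, Matrix.sub_mulVec, Matrix.one_mulVec, Matrix.mulVec_mulVec]
  set D := regDegree α β ε w with hD
  set L := regLaplacian α β ε w with hL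
  have hXD : D⁻¹ * D = 1 :=
    Matrix.nonsing_inv_mul _ ((Matrix.isUnit_iff_isUnit_det _).1 hDpos.isUnit)
  have hYL : L⁻¹ * L = 1 :=
    Matrix.nonsing_inv_mul _ ((Matrix.isUnit_iff_isUnit_det _).1 hLpos.isUnit)
  set X := D⁻¹ with hX
  set Y := L⁻¹ with hY
  set B := 1 - L * X with hB
  have hXT : Xᵀ = X := hDpos.inv.isHermitian.transpose_eq_self
  have hLT : Lᵀ = L := hLpos.isHermitian.transpose_eq_self
  have hBT : Bᵀ = 1 - X * L := by
    rw [hB, Matrix.transpose_sub, Matrix.transpose_one, Matrix.transpose_mul, hXT, hLT]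
  have hZ : (Bᵀ * Y * B).PosSemidef := by
    have := hLpos.inv.posSemidef.conjTranspose_mul_mul_same B
    simpa using this
  have hb : ∀ e, bottomLeverage α β ε w e = (α - β) e ⬝ᵥ ((Bᵀ * Y * B) *ᵥ (α - β) e) := by
    intro e
    rw [bottomLeverage, hres e, ← Matrix.mulVec_mulVec, ← Matrix.mulVec_mulVec,
      Matrix.dotProduct_mulVec ((α - β) e), Matrix.vecMul_transpose]
  simp only [hb]
  rw [← trace_mul_weightedGram]
  have hsplit : (Bᵀ * Y * B * L).trace = (Bᵀ * Y * B * weightedGram w (α - β)).trace +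
      ε * (Bᵀ * Y * B).trace := by
    nth_rewrite 1 [hL]
    rw [regLaplacian, Matrix.mul_add, Matrix.trace_add, Matrix.mul_smul, Matrix.mul_one,
      Matrix.trace_smul, smul_eq_mul]
  have hfin : Bᵀ * Y * B * L = X * (D - L) * (X * (D - L)) := by
    have h1 : X * (D - L) = 1 - X * L := by rw [Matrix.mul_sub, hXD]
    have h2 : Y * (B * L) = 1 - X * L := by
      rw [hB, Matrix.sub_mul, Matrix.one_mul, Matrix.mul_sub, hYL, Matrix.mul_assoc L,
        ← Matrix.mul_assoc Y, hYL, Matrix.one_mul]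
    rw [h1, Matrix.mul_assoc, Matrix.mul_assoc, h2, hBT]
  rw [← hfin, hsplit]
  linarith [mul_nonneg hε.le hZ.trace_nonneg]

variable {α β} in
theorem IsIncidenceFamily.sum_bottomLeverage_le {V : Type*} {blk : p → V} {hd tl : E → V}
    (h : IsIncidenceFamily blk hd tl α β) (hε : 0 < ε) {w : E → ℝ} (hw : ∀ e, 0 ≤ w e)
    {τ : ℝ} (hτ0 : 0 ≤ τ)
    (hτ : ∀ e, w e * degreeLeverage α β ε w e ≤ τ) :
    ∑ e, w e * bottomLeverage α β ε w e ≤ τ * Fintype.card p := by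
  have hDpos := regDegree_posDef α β hε hw
  have hX := fun i j => Matrix.inv_apply_eq_zero_of_block (i := i) (j := j)
    ((Matrix.isUnit_iff_isUnit_det _).1 hDpos.isUnit) blk (h.regDegree_block w)
  refine (sum_bottomLeverage_le_trace α β hε hw).trans ?_
  rw [regDegree_sub_regLaplacian, h.trace_sq_eq hX]
  have hn := fun x => hDpos.inv.posSemidef.dotProduct_mulVec_self_nonneg x
  -- For `a, b ≥ 0` with `a + b ≤ τ`, one has `2ab ≤ τ(a + b)`; this keeps one factor to be summed
  -- by the degree trace.
  have hτ' : ∀ e, 2 * ((w e * (α e ⬝ᵥ ((regDegree α β ε w)⁻¹ *ᵥ α e))) *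
      (w e * (β e ⬝ᵥ ((regDegree α β ε w)⁻¹ *ᵥ β e)))) ≤
      τ * (w e * degreeLeverage α β ε w e) := by
    intro e
    have h1 := hτ e
    have ha := mul_nonneg (hw e) (hn (α e))
    have hb := mul_nonneg (hw e) (hn (β e))
    simp only [degreeLeverage, mul_add] at h1 ⊢
    nlinarith
  refine (Finset.sum_le_sum fun e _ => hτ' e).trans ?_
  rw [← Finset.mul_sum]
  exact mul_le_mul_of_nonneg_left (sum_degreeLeverage_le α β hε hw) hτ0

end

/-! ### Deleting the edges below a gap in the weights. -/

noncomputable section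

variable {p E : Type*} [Fintype p] [Fintype E]

/-- The form `∑ (vₑ · y)²` is bounded below on a complement of its kernel; a linear right inverse of
`y ↦ (vₑ · y)` onto its range picks `y'` in such a complement. -/
theorem exists_sq_lower_bound (v : E → p → ℝ) : ∃ c > 0, ∀ y : p → ℝ, ∃ y' : p → ℝ,
    (∀ e, v e ⬝ᵥ (y - y') = 0) ∧ c * (y' ⬝ᵥ y') ≤ ∑ e, (v e ⬝ᵥ y') ^ 2 := by
  let T : (p → ℝ) →ₗ[ℝ] (E → ℝ) := (Matrix.of v).mulVecLin
  have hT : ∀ y e, T y e = v e ⬝ᵥ y := fun y e => rfl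
  obtain ⟨g, hg⟩ := LinearMap.exists_rightInverse_of_surjective T.rangeRestrict
    T.range_rangeRestrict
  set C := ‖LinearMap.toContinuousLinearMap g‖ with hC
  have hgC : ∀ z, ‖g z‖ ≤ C * ‖z‖ := fun z => (LinearMap.toContinuousLinearMap g).le_opNorm z
  refine ⟨(Fintype.card p * C ^ 2 + 1)⁻¹, by positivity, fun y => ⟨g (T.rangeRestrict y), ?_, ?_⟩⟩
  · intro e
    have h1 : T.rangeRestrict (g (T.rangeRestrict y)) = T.rangeRestrict y :=
      LinearMap.congr_fun hg (T.rangeRestrict y)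
    have h2 : T (g (T.rangeRestrict y)) = T y := congrArg Subtype.val h1
    rw [← hT, map_sub, h2, sub_self, Pi.zero_apply]
  · set y' := g (T.rangeRestrict y) with hy'
    have h1 : T.rangeRestrict y' = T.rangeRestrict y :=
      LinearMap.congr_fun hg (T.rangeRestrict y)
    have h2 : T y' = T y := congrArg Subtype.val h1
    have h3 : ‖y'‖ ≤ C * ‖T y'‖ := by
      rw [h2]; exact hgC (T.rangeRestrict y)
    have h4 : y' ⬝ᵥ y' ≤ Fintype.card p * ‖y'‖ ^ 2 := by
      have : ∀ i ∈ Finset.univ, y' i * y' i ≤ ‖y'‖ ^ 2 := fun i _ => by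
        have := norm_le_pi_norm y' i
        rw [Real.norm_eq_abs] at this
        nlinarith [abs_mul_abs_self (y' i), abs_nonneg (y' i)]
      simpa [dotProduct] using Finset.sum_le_card_nsmul _ _ _ this
    have h5 : ‖T y'‖ ^ 2 ≤ ∑ e, (v e ⬝ᵥ y') ^ 2 := by
      have hnn : 0 ≤ ∑ e, (v e ⬝ᵥ y') ^ 2 := Finset.sum_nonneg fun e _ => sq_nonneg _
      have : ‖T y'‖ ≤ Real.sqrt (∑ e, (v e ⬝ᵥ y') ^ 2) := by
        refine (pi_norm_le_iff_of_nonneg (Real.sqrt_nonneg _)).2 fun e => ?_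
        rw [hT]
        refine Real.abs_le_sqrt ?_
        exact Finset.single_le_sum (f := fun e => (v e ⬝ᵥ y') ^ 2) (fun e _ => sq_nonneg _)
          (Finset.mem_univ e)
      calc ‖T y'‖ ^ 2 ≤ Real.sqrt (∑ e, (v e ⬝ᵥ y') ^ 2) ^ 2 :=
            pow_le_pow_left₀ (norm_nonneg _) this 2
        _ = _ := Real.sq_sqrt hnn
    rw [inv_mul_le_iff₀ (by positivity)]
    have h6 : ‖y'‖ ^ 2 ≤ C ^ 2 * ‖T y'‖ ^ 2 := by
      rw [← mul_pow]; exact pow_le_pow_left₀ (norm_nonneg _) h3 2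
    calc y' ⬝ᵥ y' ≤ Fintype.card p * (C ^ 2 * ‖T y'‖ ^ 2) :=
          h4.trans (mul_le_mul_of_nonneg_left h6 (Nat.cast_nonneg _))
      _ ≤ (Fintype.card p * C ^ 2 + 1) * ‖T y'‖ ^ 2 := by nlinarith [sq_nonneg ‖T y'‖]
      _ ≤ _ := mul_le_mul_of_nonneg_left h5 (by positivity)

theorem exists_sq_lower_bound_uniform [DecidableEq E] (v : E → p → ℝ) : ∃ c > 0,
    ∀ (S : Finset E) (y : p → ℝ), ∃ y' : p → ℝ,
      (∀ e ∈ S, v e ⬝ᵥ (y - y') = 0) ∧ c * (y' ⬝ᵥ y') ≤ ∑ e ∈ S, (v e ⬝ᵥ y') ^ 2 := by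
  have h := fun S : Finset E => exists_sq_lower_bound fun e : S => v e
  choose c hc hcS using h
  obtain ⟨S₀, hS₀⟩ := Finite.exists_min c
  refine ⟨c S₀, hc S₀, fun S y => ?_⟩
  obtain ⟨y', h1, h2⟩ := hcS S y
  refine ⟨y', fun e he => h1 ⟨e, he⟩, ?_⟩
  rw [← Finset.sum_coe_sort S fun e => (v e ⬝ᵥ y') ^ 2]
  refine (mul_le_mul_of_nonneg_right (hS₀ S) ?_).trans h2
  exact Finset.sum_nonneg fun i _ => mul_self_nonneg _

theorem sum_sq_dotProduct_le (v : E → p → ℝ) (y : p → ℝ) :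
    ∑ e, (v e ⬝ᵥ y) ^ 2 ≤ (∑ e, v e ⬝ᵥ v e) * (y ⬝ᵥ y) := by
  rw [Finset.sum_mul]
  refine Finset.sum_le_sum fun e _ => ?_
  have := Finset.sum_mul_sq_le_sq_mul_sq Finset.univ (v e) y
  simpa [dotProduct, sq] using this

/-- Where the weights of a family of vectors are separated by a large factor, the small ones and
the regularization are negligible, up to vectors that are invisible to the large ones. -/
theorem exists_small_relative_error [DecidableEq E] (v : E → p → ℝ) : ∃ M₀ > 0,
    ∀ (S : Finset E) (w : E → ℝ) (ε K M : ℝ), 0 < ε → 1 ≤ K → 0 < M →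
      (∀ e ∉ S, w e ≤ K * ε) → (∀ e ∈ S, M * (K * ε) ≤ w e) → ∀ y : p → ℝ, ∃ y' : p → ℝ,
        (∀ e ∈ S, v e ⬝ᵥ (y - y') = 0) ∧
        ∑ e ∈ Sᶜ, w e * (v e ⬝ᵥ y') ^ 2 + ε * (y' ⬝ᵥ y') ≤
          M₀ / M * ∑ e ∈ S, w e * (v e ⬝ᵥ y') ^ 2 := by
  obtain ⟨c, hc, hcS⟩ := exists_sq_lower_bound_uniform v
  set C := ∑ e, v e ⬝ᵥ v e with hC
  have hC0 : 0 ≤ C := Finset.sum_nonneg fun e _ => Finset.sum_nonneg fun i _ => mul_self_nonneg _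
  refine ⟨(C + 1) / c, by positivity, fun S w ε K M hε hK hM hsmall hlarge y => ?_⟩
  obtain ⟨y', h1, h2⟩ := hcS S y
  refine ⟨y', h1, ?_⟩
  have hy : 0 ≤ y' ⬝ᵥ y' := Finset.sum_nonneg fun i _ => mul_self_nonneg _
  have h3 : ∑ e ∈ Sᶜ, w e * (v e ⬝ᵥ y') ^ 2 ≤ K * ε * (C * (y' ⬝ᵥ y')) := by
    refine le_trans ?_ (mul_le_mul_of_nonneg_left (sum_sq_dotProduct_le v y') (by positivity))
    rw [Finset.mul_sum]
    refine le_trans (Finset.sum_le_sum fun e he => mul_le_mul_of_nonneg_right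
      (hsmall e (Finset.mem_compl.1 he)) (sq_nonneg _)) ?_
    exact Finset.sum_le_univ_sum_of_nonneg fun e => by positivity
  have h4 : M * (K * ε) * ∑ e ∈ S, (v e ⬝ᵥ y') ^ 2 ≤ ∑ e ∈ S, w e * (v e ⬝ᵥ y') ^ 2 := by
    rw [Finset.mul_sum]
    exact Finset.sum_le_sum fun e he => mul_le_mul_of_nonneg_right (hlarge e he) (sq_nonneg _)
  calc _ ≤ K * ε * (C * (y' ⬝ᵥ y')) + K * ε * (y' ⬝ᵥ y') := by
        refine add_le_add h3 (mul_le_mul_of_nonneg_right ?_ hy)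
        nlinarith
    _ = (C + 1) / c / M * (M * (K * ε) * (c * (y' ⬝ᵥ y'))) := by
        field_simp
    _ ≤ (C + 1) / c / M * (M * (K * ε) * ∑ e ∈ S, (v e ⬝ᵥ y') ^ 2) := by gcongr
    _ ≤ _ := mul_le_mul_of_nonneg_left h4 (by positivity)

/-- Pigeonhole: the `|E| + 1` disjoint intervals `(M^j ε, M^(j+1) ε]` cannot all contain one of the
`|E|` weights. -/
theorem exists_gap (w : E → ℝ) {M ε : ℝ} (hM : 1 < M) (hε : 0 < ε) :
    ∃ j ≤ Fintype.card E, ∀ e, w e ≤ M ^ j * ε ∨ M ^ (j + 1) * ε < w e := by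
  by_contra! h
  choose f hf using fun j : Fin (Fintype.card E + 1) => h j (Nat.lt_succ_iff.1 j.2)
  obtain ⟨i, j, hij, hfij⟩ := Fintype.exists_ne_map_eq_of_card_lt f (by simp)
  wlog hlt : i < j generalizing i j
  · exact this j i hij.symm hfij.symm (lt_of_le_of_ne (not_lt.1 hlt) hij.symm)
  have h1 := (hf i).2
  have h2 := (hf j).1
  rw [hfij] at h1
  have : M ^ ((i : ℕ) + 1) ≤ M ^ (j : ℕ) := pow_le_pow_right₀ hM.le hlt
  nlinarith

theorem weightedGram_sub_form [DecidableEq E] (v : E → p → ℝ) (w : E → ℝ) (S : Finset E)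
    (x : p → ℝ) :
    x ⬝ᵥ (weightedGram w v *ᵥ x) =
      x ⬝ᵥ (weightedGram (fun e => if e ∈ S then w e else 0) v *ᵥ x) +
        ∑ e ∈ Sᶜ, w e * (v e ⬝ᵥ x) ^ 2 := by
  simp only [dotProduct_weightedGram_mulVec, ite_mul, zero_mul, ← sq]
  rw [Finset.sum_ite_mem, Finset.univ_inter, Finset.sum_add_sum_compl]

theorem weightedGram_mulVec_eq_zero {w : E → ℝ} {v : E → p → ℝ} {x : p → ℝ}
    (h : ∀ e, w e ≠ 0 → v e ⬝ᵥ x = 0) : weightedGram w v *ᵥ x = 0 := by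
  simp only [weightedGram, Matrix.sum_mulVec, Matrix.smul_mulVec, Matrix.vecMulVec_mulVec]
  refine Finset.sum_eq_zero fun e _ => ?_
  by_cases hw : w e = 0
  · simp [hw]
  · simp [h e hw]

variable [DecidableEq p] [DecidableEq E]

theorem weightedGram_ite_form (v : E → p → ℝ) (w : E → ℝ) (S : Finset E) (x : p → ℝ) :
    x ⬝ᵥ (weightedGram (fun e => if e ∈ S then w e else 0) v *ᵥ x) =
      ∑ e ∈ S, w e * (v e ⬝ᵥ x) ^ 2 := by
  simp only [dotProduct_weightedGram_mulVec, ite_mul, zero_mul, ← sq]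
  rw [Finset.sum_ite_mem, Finset.univ_inter]

/-- For a small regularization, the edges of small weight may be deleted. -/
theorem exists_truncation (α β : E → p → ℝ) {η : ℝ} (hη : 0 < η) : ∃ ε > 0, ∀ w : E → ℝ,
    ∃ S : Finset E, (∀ e ∉ S, w e < 1) ∧
      (∀ y : p → ℝ, ∃ y' : p → ℝ, (∀ e ∈ S, α e ⬝ᵥ (y - y') = 0 ∧ β e ⬝ᵥ (y - y') = 0) ∧
        y' ⬝ᵥ (regDegree α β ε w *ᵥ y') ≤
          (1 + η) * (y' ⬝ᵥ ((weightedGram (fun e => if e ∈ S then w e else 0) α +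
            weightedGram (fun e => if e ∈ S then w e else 0) β) *ᵥ y'))) ∧
      (∀ y : p → ℝ, ∃ y' : p → ℝ, (∀ e ∈ S, (α - β) e ⬝ᵥ (y - y') = 0) ∧
        y' ⬝ᵥ (regLaplacian α β ε w *ᵥ y') ≤
          (1 + η) * (y' ⬝ᵥ (weightedGram (fun e => if e ∈ S then w e else 0) (α - β) *ᵥ y'))) := by
  obtain ⟨M₁, hM₁, h₁⟩ := exists_small_relative_error (Sum.elim α β)
  obtain ⟨M₂, hM₂, h₂⟩ := exists_small_relative_error (α - β)
  set M := 1 + (M₁ + M₂) / η with hM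
  have hM1 : 1 < M := by rw [hM]; linarith [div_pos (add_pos hM₁ hM₂) hη]
  have hM0 : 0 < M := by linarith
  have hηM : M₁ + M₂ ≤ η * M := by
    rw [hM, mul_add, mul_div_cancel₀ _ hη.ne']; linarith
  have hM₁' : M₁ / M ≤ η := by rw [div_le_iff₀ hM0]; linarith
  have hM₂' : M₂ / M ≤ η := by rw [div_le_iff₀ hM0]; linarith
  have hpow : 0 < M ^ Fintype.card E := pow_pos hM0 _
  -- The gap starts at `M^j ε` with `j ≤ |E|`, hence at height at most `1/2`; so every deleted edge
  -- has weight below `1`.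
  refine ⟨1 / (2 * M ^ Fintype.card E), by positivity, fun w => ?_⟩
  set ε := 1 / (2 * M ^ Fintype.card E) with hε
  have hε0 : 0 < ε := by positivity
  obtain ⟨j, hj, hgap⟩ := exists_gap w hM1 hε0
  set K := M ^ j with hK
  have hK1 : 1 ≤ K := one_le_pow₀ hM1.le
  have hKε : K * ε < 1 := by
    have : K ≤ M ^ Fintype.card E := pow_le_pow_right₀ hM1.le hj
    rw [hε, mul_one_div, div_lt_one (by positivity)]
    linarith
  let S : Finset E := Finset.univ.filter fun e => M * (K * ε) < w e
  have hsmall : ∀ e ∉ S, w e ≤ K * ε := fun e he => by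
    rcases hgap e with h | h
    · exact h
    · refine absurd (Finset.mem_filter.2 ⟨Finset.mem_univ e, ?_⟩) he
      rw [pow_succ] at h
      linarith
  have hlarge : ∀ e ∈ S, M * (K * ε) ≤ w e := fun e he => (Finset.mem_filter.1 he).2.le
  refine ⟨S, fun e he => (hsmall e he).trans_lt hKε, fun y => ?_, fun y => ?_⟩
  · obtain ⟨y', h3, h4⟩ := h₁ (S.disjSum S) (Sum.elim w w) ε K M hε0 hK1 hM0
      (by
        rintro (e | e) he
        · exact hsmall e fun h => he (Finset.inl_mem_disjSum.2 h)
        · exact hsmall e fun h => he (Finset.inr_mem_disjSum.2 h))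
      (by
        rintro (e | e) he
        · exact hlarge e (Finset.inl_mem_disjSum.1 he)
        · exact hlarge e (Finset.inr_mem_disjSum.1 he)) y
    refine ⟨y', fun e he => ⟨h3 (Sum.inl e) (Finset.inl_mem_disjSum.2 he),
      h3 (Sum.inr e) (Finset.inr_mem_disjSum.2 he)⟩, ?_⟩
    have hcompl : (S.disjSum S)ᶜ = Sᶜ.disjSum Sᶜ := by
      ext (e | e) <;> simp
    rw [hcompl, Finset.sum_disjSum, Finset.sum_disjSum] at h4
    simp only [Sum.elim_inl, Sum.elim_inr] at h4
    simp only [regDegree, Matrix.add_mulVec, dotProduct_add, weightedGram_sub_form _ w S,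
      Matrix.smul_mulVec, Matrix.one_mulVec, dotProduct_smul, smul_eq_mul]
    simp only [weightedGram_ite_form]
    have hnn : 0 ≤ ∑ e ∈ S, w e * (α e ⬝ᵥ y') ^ 2 + ∑ e ∈ S, w e * (β e ⬝ᵥ y') ^ 2 := by
      have hw : ∀ e ∈ S, 0 ≤ w e := fun e he => le_trans (by positivity) (hlarge e he)
      exact add_nonneg (Finset.sum_nonneg fun e he => mul_nonneg (hw e he) (sq_nonneg _))
        (Finset.sum_nonneg fun e he => mul_nonneg (hw e he) (sq_nonneg _))
    linarith [mul_le_mul_of_nonneg_right hM₁' hnn]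
  · obtain ⟨y', h3, h4⟩ := h₂ S w ε K M hε0 hK1 hM0 hsmall hlarge y
    refine ⟨y', h3, ?_⟩
    simp only [regLaplacian, Matrix.add_mulVec, dotProduct_add, weightedGram_sub_form _ w S,
      Matrix.smul_mulVec, Matrix.one_mulVec, dotProduct_smul, smul_eq_mul]
    simp only [weightedGram_ite_form]
    have hnn : 0 ≤ ∑ e ∈ S, w e * ((α - β) e ⬝ᵥ y') ^ 2 :=
      Finset.sum_nonneg fun e he =>
        mul_nonneg (le_trans (by positivity) (hlarge e he)) (sq_nonneg _)
    linarith [mul_le_mul_of_nonneg_right hM₂' hnn]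

end

/-! ### Comparing pseudoinverse forms with regularized inverses. -/

noncomputable section

variable {p E : Type*} [Fintype p] [DecidableEq p]

theorem Matrix.PosSemidef.dotProduct_mulVec_eq_of_mulVec_sub_eq_zero {A : Matrix p p ℝ}
    (hA : A.PosSemidef) {y y' : p → ℝ} (h : A *ᵥ (y - y') = 0) (x : p → ℝ) :
    y ⬝ᵥ (A *ᵥ x) = y' ⬝ᵥ (A *ᵥ x) := by
  rw [hA.dotProduct_mulVec_comm y, hA.dotProduct_mulVec_comm y', ← sub_eq_zero, ← dotProduct_sub,
    ← Matrix.mulVec_sub, h, dotProduct_zero]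

/-- In the application `z = D₀† a`, for which both hypotheses on `t` hold with `t = aᵀ D₀† a`.
Testing the dual description of `aᵀ D⁻¹ a` at `z'` gives `(1 - η) t ≤ aᵀ D⁻¹ a`. -/
theorem leverage_le_of_relative_error {D₀ D : Matrix p p ℝ} (hD : D.PosDef)
    (hD₀ : D₀.PosSemidef) {η : ℝ} (hη : η ≤ 1 / 2) {z z' a : p → ℝ}
    (hz' : D₀ *ᵥ (z - z') = 0) (hza : a ⬝ᵥ (z - z') = 0)
    (hqz : z' ⬝ᵥ (D *ᵥ z') ≤ (1 + η) * (z' ⬝ᵥ (D₀ *ᵥ z')))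
    {t : ℝ} (h1 : z ⬝ᵥ (D₀ *ᵥ z) = t) (h2 : z ⬝ᵥ a = t) : t ≤ 2 * (a ⬝ᵥ (D⁻¹ *ᵥ a)) := by
  have h3 : z' ⬝ᵥ (D₀ *ᵥ z') = t := by
    rw [← h1, hD₀.dotProduct_mulVec_eq_of_mulVec_sub_eq_zero hz' z,
      hD₀.dotProduct_mulVec_comm z' z, hD₀.dotProduct_mulVec_eq_of_mulVec_sub_eq_zero hz' z']
  have h4 : z' ⬝ᵥ a = t := by
    rw [← h2, dotProduct_comm, dotProduct_comm z, eq_comm, ← sub_eq_zero, ← dotProduct_sub, hza]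
  have h5 := hD.two_mul_dotProduct_sub_le z' a
  have ht : 0 ≤ t := h1 ▸ hD₀.dotProduct_mulVec_self_nonneg z
  rw [h3] at hqz
  rw [h4] at h5
  nlinarith

/-- The relation `L₀ y = D₀ z` replaces spectral calculus. With `g = D⁻¹ b`, the dual description of
the residual form is tested at `y'/2`. There `y'ᵀ b = B`, while `y'ᵀ L g` is, up to truncation
errors, `z'ᵀ D g = zᵀ b ≤ ζB ≤ B/4`; so a fixed fraction of `B` survives. This is the inequality
`1/λ ≲ (1 - λ)²/λ` for small `λ`, in a form stable under perturbation. -/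
theorem bottom_le_of_relative_error {D₀ L₀ D L : Matrix p p ℝ} (hD : D.PosDef) (hL : L.PosDef)
    (hD₀ : D₀.PosSemidef) (hL₀ : L₀.PosSemidef) (hDD : (D - D₀).PosSemidef)
    (hLL : (L - L₀).PosSemidef) (hLD : ((2 : ℝ) • D - L).PosSemidef) {η : ℝ} (hη0 : 0 < η)
    (hη : η ≤ 1 / 2) {y y' z z' b : p → ℝ} (hy' : L₀ *ᵥ (y - y') = 0) (hz' : D₀ *ᵥ (z - z') = 0)
    (hyb : b ⬝ᵥ (y - y') = 0) (hzb : b ⬝ᵥ (z - z') = 0)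
    (hqy : y' ⬝ᵥ (L *ᵥ y') ≤ (1 + η) * (y' ⬝ᵥ (L₀ *ᵥ y')))
    (hqz : z' ⬝ᵥ (D *ᵥ z') ≤ (1 + η) * (z' ⬝ᵥ (D₀ *ᵥ z')))
    (hyz : L₀ *ᵥ y = D₀ *ᵥ z) {B ζ : ℝ} (hζ : ζ ≤ 1 / 4) (hB : y ⬝ᵥ b = B)
    (hBL : y ⬝ᵥ (L₀ *ᵥ y) = B) (hzB : z ⬝ᵥ b ≤ ζ * B) (hzD : z ⬝ᵥ (D₀ *ᵥ z) ≤ ζ * B) :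
    B ≤ 4 * ((b - L *ᵥ (D⁻¹ *ᵥ b)) ⬝ᵥ (L⁻¹ *ᵥ (b - L *ᵥ (D⁻¹ *ᵥ b)))) +
      48 * η * (b ⬝ᵥ (D⁻¹ *ᵥ b)) := by
  set g := D⁻¹ *ᵥ b with hg
  set G := b ⬝ᵥ g with hG
  have hDg : D *ᵥ g = b := by
    rw [hg, Matrix.mulVec_mulVec,
      Matrix.mul_nonsing_inv _ ((Matrix.isUnit_iff_isUnit_det _).1 hD.isUnit), Matrix.one_mulVec]
  have hgDg : g ⬝ᵥ (D *ᵥ g) = G := by rw [hDg, dotProduct_comm]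
  have hB0 : 0 ≤ B := hBL ▸ hL₀.dotProduct_mulVec_self_nonneg y
  have hy1 : y' ⬝ᵥ (L₀ *ᵥ y') = B := by
    rw [← hBL, hL₀.dotProduct_mulVec_eq_of_mulVec_sub_eq_zero hy' y,
      hL₀.dotProduct_mulVec_comm y' y, hL₀.dotProduct_mulVec_eq_of_mulVec_sub_eq_zero hy' y']
  have hz1 : z' ⬝ᵥ (D₀ *ᵥ z') = z ⬝ᵥ (D₀ *ᵥ z) := by
    rw [hD₀.dotProduct_mulVec_eq_of_mulVec_sub_eq_zero hz' z,
      hD₀.dotProduct_mulVec_comm z' z, hD₀.dotProduct_mulVec_eq_of_mulVec_sub_eq_zero hz' z']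
  have hy2 : y' ⬝ᵥ b = B := by
    rw [← hB, dotProduct_comm, dotProduct_comm y, eq_comm, ← sub_eq_zero, ← dotProduct_sub, hyb]
  have hz2 : z' ⬝ᵥ b = z ⬝ᵥ b := by
    rw [dotProduct_comm, dotProduct_comm z, eq_comm, ← sub_eq_zero, ← dotProduct_sub, hzb]
  have hcross : y' ⬝ᵥ (L₀ *ᵥ g) = z' ⬝ᵥ (D₀ *ᵥ g) := by
    rw [← hL₀.dotProduct_mulVec_eq_of_mulVec_sub_eq_zero hy' g,
      ← hD₀.dotProduct_mulVec_eq_of_mulVec_sub_eq_zero hz' g, hL₀.dotProduct_mulVec_comm, hyz,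
      hD₀.dotProduct_mulVec_comm]
  -- The factor `1/(8η)` balances Cauchy-Schwarz: the forms of `D - D₀` at `z'` and of `L - L₀` at
  -- `y'` are at most `ηB/4` and `ηB`, so they cost only `B/32` and `B/8`, and the rest is a
  -- multiple of `η bᵀ D⁻¹ b`.
  have e1 := hDD.two_mul_dotProduct_mulVec_le (-z') g (κ := 1 / (8 * η)) (by positivity)
  have e2 := hLL.two_mul_dotProduct_mulVec_le y' g (κ := 1 / (8 * η)) (by positivity)
  have hD₀g := hD₀.dotProduct_mulVec_self_nonneg g
  have hL₀g := hL₀.dotProduct_mulVec_self_nonneg g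
  have hLDg := hLD.dotProduct_mulVec_self_nonneg g
  have h5 := hL.two_mul_dotProduct_sub_le ((1 / 2 : ℝ) • y') (b - L *ᵥ g)
  simp only [Matrix.sub_mulVec, dotProduct_sub, Matrix.smul_mulVec, Matrix.mulVec_neg,
    neg_dotProduct, dotProduct_neg, dotProduct_smul, smul_dotProduct, Matrix.mulVec_smul,
    smul_eq_mul, div_div_eq_mul_div, div_one] at e1 e2 hLDg h5
  rw [hgDg] at e1 hLDg
  rw [hDg, hz2] at e1
  rw [hy2] at h5
  rw [hy1] at hqy e2
  rw [hz1] at hqz e1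
  have k1 : 1 / (8 * η) * (z' ⬝ᵥ (D *ᵥ z') - z ⬝ᵥ (D₀ *ᵥ z)) ≤ B / 32 := by
    rw [one_div_mul_eq_div, div_le_iff₀ (by positivity)]
    have : z ⬝ᵥ (D₀ *ᵥ z) ≤ B / 4 := by linarith [mul_le_mul_of_nonneg_right hζ hB0]
    linarith [mul_le_mul_of_nonneg_left this hη0.le]
  have k2 : 1 / (8 * η) * (y' ⬝ᵥ (L *ᵥ y') - B) ≤ B / 8 := by
    rw [one_div_mul_eq_div, div_le_iff₀ (by positivity)]
    linarith
  have k3 : (G - g ⬝ᵥ (D₀ *ᵥ g)) * (8 * η) ≤ G * (8 * η) :=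
    mul_le_mul_of_nonneg_right (by linarith) (by positivity)
  have k4 : (g ⬝ᵥ (L *ᵥ g) - g ⬝ᵥ (L₀ *ᵥ g)) * (8 * η) ≤ 2 * G * (8 * η) :=
    mul_le_mul_of_nonneg_right (by linarith) (by positivity)
  have k5 : ζ * B ≤ 1 / 4 * B := mul_le_mul_of_nonneg_right hζ hB0
  have k6 : η * B ≤ 1 / 2 * B := mul_le_mul_of_nonneg_right hη hB0
  have k7 : y' ⬝ᵥ (L *ᵥ y') ≤ 3 / 2 * B := by linarith
  linarith

end

/-! ### The weights of the decomposition. -/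

noncomputable section

variable {p E : Type*} [Fintype p] [DecidableEq p] [Fintype E]

theorem weightedGram_sub_weightedGram (w w' : E → ℝ) (v : E → p → ℝ) :
    weightedGram w v - weightedGram w' v = weightedGram (w - w') v := by
  simp only [weightedGram, ← Finset.sum_sub_distrib, ← sub_smul, Pi.sub_apply]

theorem two_smul_regDegree_sub_regLaplacian (α β : E → p → ℝ) (ε : ℝ) (w : E → ℝ) :
    (2 : ℝ) • regDegree α β ε w - regLaplacian α β ε w = weightedGram w (α + β) + ε • 1 := by
  have h : (2 : ℝ) • (weightedGram w α + weightedGram w β) - weightedGram w (α - β) =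
      weightedGram w (α + β) := by
    simp only [weightedGram, ← Finset.sum_add_distrib, Finset.smul_sum, ← Finset.sum_sub_distrib]
    refine Finset.sum_congr rfl fun e _ => ?_
    ext i j
    simp [Matrix.vecMulVec_apply]
    ring
  rw [← h, regDegree, regLaplacian, smul_add, two_smul ℝ (ε • (1 : Matrix p p ℝ))]
  abel

theorem quadForm_sqrt_smul {X : Matrix p p ℝ} {t : ℝ} (ht : 0 ≤ t) (x : p → ℝ) :
    (Real.sqrt t • x) ⬝ᵥ (X *ᵥ (Real.sqrt t • x)) = t * (x ⬝ᵥ (X *ᵥ x)) := by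
  rw [Matrix.mulVec_smul, dotProduct_smul, smul_dotProduct, smul_eq_mul, smul_eq_mul, ← mul_assoc,
    Real.mul_self_sqrt ht]

theorem sub_form_le_two_mul_degreeLeverage (α β : E → p → ℝ) {ε : ℝ} (hε : 0 < ε) {w : E → ℝ}
    (hw : ∀ e, 0 ≤ w e) (e : E) :
    (α - β) e ⬝ᵥ ((regDegree α β ε w)⁻¹ *ᵥ (α - β) e) ≤ 2 * degreeLeverage α β ε w e := by
  have hX := (regDegree_posDef α β hε hw).inv.posSemidef
  have h := hX.dotProduct_mulVec_self_nonneg (α e + β e)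
  simp only [Pi.sub_apply, degreeLeverage, Matrix.mulVec_add, Matrix.mulVec_sub, add_dotProduct,
    dotProduct_add, sub_dotProduct, dotProduct_sub] at h ⊢
  linarith

open Classical in
/-- The weights of the decomposition: the leverage scores and the bottom of the normalized
Laplacian are controlled by the variational properties of the vectors `z` and `y` which represent them. -/
theorem IsIncidenceFamily.exists_weights {V : Type*} {blk : p → V} {hd tl : E → V}
    {α β : E → p → ℝ} (h : IsIncidenceFamily blk hd tl α β) {τ₁ τ₂ : ℝ} (hτ₁ : 0 < τ₁)
    (hτ₂ : 0 < τ₂) : ∃ w : E → ℝ, (∀ e, 0 ≤ w e ∧ w e ≤ 1) ∧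
      ((Finset.univ.filter fun e => w e < 1).card : ℝ) ≤
        Fintype.card p / τ₁ + τ₁ * Fintype.card p / τ₂ ∧
      (∀ e z t, z ⬝ᵥ ((weightedGram w α + weightedGram w β) *ᵥ z) = t →
        (z ⬝ᵥ (Real.sqrt (w e) • α e) = t ∨ z ⬝ᵥ (Real.sqrt (w e) • β e) = t) → t ≤ 2 * τ₁) ∧
      (∀ e y z B ζ, ζ ≤ 1 / 4 →
        weightedGram w (α - β) *ᵥ y = (weightedGram w α + weightedGram w β) *ᵥ z →
        y ⬝ᵥ (Real.sqrt (w e) • (α - β) e) = B → y ⬝ᵥ (weightedGram w (α - β) *ᵥ y) = B →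
        z ⬝ᵥ (Real.sqrt (w e) • (α - β) e) ≤ ζ * B →
        z ⬝ᵥ ((weightedGram w α + weightedGram w β) *ᵥ z) ≤ ζ * B → B ≤ 8 * τ₂) := by
  -- The error `48η bᵀ D⁻¹ b` is at most `96ητ₁` on a weighted edge vector; this choice makes it at
  -- most `4τ₂`, as large as the main term.
  set η := min (1 / 2) (τ₂ / (24 * τ₁)) with hη
  have hη0 : 0 < η := by positivity
  have hη2 : η ≤ 1 / 2 := min_le_left _ _
  have hητ : 96 * η * τ₁ ≤ 4 * τ₂ := by
    have := min_le_right (1 / 2) (τ₂ / (24 * τ₁))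
    rw [← hη, le_div_iff₀ (by positivity)] at this
    linarith
  obtain ⟨ε, hε, htr⟩ := exists_truncation α β hη0
  obtain ⟨w, hw⟩ := exists_complementary_weights
    (r := fun w e => degreeLeverage α β ε w e / τ₁ + bottomLeverage α β ε w e / τ₂)
    fun e => ((continuous_degreeLeverage α β hε e).div_const _).add
      ((continuous_bottomLeverage α β hε e).div_const _)
  have hw0 : ∀ e, 0 ≤ w e := fun e => (hw e).1.le
  obtain ⟨S, hS1, hSD, hSL⟩ := htr w
  set w' : E → ℝ := fun e => if e ∈ S then w e else 0 with hw'
  have hw'0 : ∀ e, 0 ≤ w' e := fun e => by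
    simp only [hw']; split_ifs <;> [exact hw0 e; exact le_rfl]
  have hdeg0 := degreeLeverage_nonneg α β hε hw0
  have hbot0 := bottomLeverage_nonneg α β hε hw0
  have hdeg : ∀ e, w e * degreeLeverage α β ε w e ≤ τ₁ := fun e => by
    have h1 := (hw e).2.2.1
    have h2 : 0 ≤ w e * (bottomLeverage α β ε w e / τ₂) :=
      mul_nonneg (hw0 e) (div_nonneg (hbot0 e) hτ₂.le)
    rw [mul_add, ← mul_div_assoc] at h1
    exact (div_le_one hτ₁).1 (by linarith)
  have hbot : ∀ e, w e * bottomLeverage α β ε w e ≤ τ₂ := fun e => by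
    have h1 := (hw e).2.2.1
    have h2 : 0 ≤ w e * (degreeLeverage α β ε w e / τ₁) :=
      mul_nonneg (hw0 e) (div_nonneg (hdeg0 e) hτ₁.le)
    rw [mul_add, ← mul_div_assoc (w e) (bottomLeverage _ _ _ _ _)] at h1
    exact (div_le_one hτ₂).1 (by linarith)
  have hDpos := regDegree_posDef α β hε hw0
  have hLpos := regLaplacian_posDef α β hε hw0
  have hD₀ : (weightedGram w' α + weightedGram w' β).PosSemidef :=
    (weightedGram_posSemidef hw'0 α).add (weightedGram_posSemidef hw'0 β)
  have hL₀ : (weightedGram w' (α - β)).PosSemidef := weightedGram_posSemidef hw'0 _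
  have hsub : ∀ e, 0 ≤ (w - w') e := fun e => by
    simp only [hw', Pi.sub_apply]
    split_ifs
    · simp
    · simpa using hw0 e
  have hε1 : (ε • (1 : Matrix p p ℝ)).PosSemidef := Matrix.PosSemidef.one.smul hε.le
  have hDD : (regDegree α β ε w - (weightedGram w' α + weightedGram w' β)).PosSemidef := by
    have : regDegree α β ε w - (weightedGram w' α + weightedGram w' β) =
        weightedGram (w - w') α + weightedGram (w - w') β + ε • 1 := by
      rw [← weightedGram_sub_weightedGram, ← weightedGram_sub_weightedGram, regDegree]
      abel
    rw [this]
    exact ((weightedGram_posSemidef hsub α).add (weightedGram_posSemidef hsub β)).add hε1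
  have hLL : (regLaplacian α β ε w - weightedGram w' (α - β)).PosSemidef := by
    have : regLaplacian α β ε w - weightedGram w' (α - β) =
        weightedGram (w - w') (α - β) + ε • 1 := by
      rw [← weightedGram_sub_weightedGram, regLaplacian]
      abel
    rw [this]
    exact (weightedGram_posSemidef hsub _).add hε1
  have hLD : ((2 : ℝ) • regDegree α β ε w - regLaplacian α β ε w).PosSemidef := by
    rw [two_smul_regDegree_sub_regLaplacian]
    exact (weightedGram_posSemidef hw0 _).add hε1
  have hmem : ∀ e, w' e ≠ 0 → e ∈ S := fun e he => by
    by_contra hn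
    exact he (by simp [hw', hn])
  have hkerD : ∀ x, (∀ e ∈ S, α e ⬝ᵥ x = 0 ∧ β e ⬝ᵥ x = 0) →
      (weightedGram w' α + weightedGram w' β) *ᵥ x = 0 := fun x hx => by
    rw [Matrix.add_mulVec, weightedGram_mulVec_eq_zero fun e he => (hx e (hmem e he)).1,
      weightedGram_mulVec_eq_zero fun e he => (hx e (hmem e he)).2, add_zero]
  have hkerL : ∀ x, (∀ e ∈ S, (α - β) e ⬝ᵥ x = 0) → weightedGram w' (α - β) *ᵥ x = 0 :=
    fun x hx => weightedGram_mulVec_eq_zero fun e he => hx e (hmem e he)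
  refine ⟨w', fun e => ⟨hw'0 e, ?_⟩, ?_, ?_, ?_⟩
  · simp only [hw']; split_ifs <;> [exact (hw e).2.1; exact zero_le_one]
  -- Truncation creates no new rescaled edges: those it deletes had weight below `1`. On the edges
  -- with `w e < 1` the complementarity `w r = 1` turns the count into a sum.
  · have hsubset : (Finset.univ.filter fun e => w' e < 1) ⊆ Finset.univ.filter fun e => w e < 1 := by
      intro e he
      simp only [Finset.mem_filter, Finset.mem_univ, true_and, hw'] at he ⊢
      by_cases heS : e ∈ S
      · simpa [heS] using he
      · exact hS1 e heS
    calc ((Finset.univ.filter fun e => w' e < 1).card : ℝ)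
        ≤ (Finset.univ.filter fun e => w e < 1).card := by
          exact_mod_cast Finset.card_le_card hsubset
      _ = ∑ e with w e < 1, w e *
            (degreeLeverage α β ε w e / τ₁ + bottomLeverage α β ε w e / τ₂) := by
          rw [Finset.card_eq_sum_ones, Nat.cast_sum]
          refine Finset.sum_congr rfl fun e he => ?_
          rw [(hw e).2.2.2 (Finset.mem_filter.1 he).2, Nat.cast_one]
      _ ≤ ∑ e, w e * (degreeLeverage α β ε w e / τ₁ + bottomLeverage α β ε w e / τ₂) :=
          Finset.sum_le_univ_sum_of_nonneg fun e => mul_nonneg (hw0 e)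
            (add_nonneg (div_nonneg (hdeg0 e) hτ₁.le) (div_nonneg (hbot0 e) hτ₂.le))
      _ = (∑ e, w e * degreeLeverage α β ε w e) / τ₁ +
            (∑ e, w e * bottomLeverage α β ε w e) / τ₂ := by
          simp only [mul_add, Finset.sum_add_distrib, Finset.sum_div, mul_div_assoc]
      _ ≤ _ := add_le_add
          (div_le_div_of_nonneg_right (sum_degreeLeverage_le α β hε hw0) hτ₁.le)
          (div_le_div_of_nonneg_right (h.sum_bottomLeverage_le hε hw0 hτ₁.le hdeg) hτ₂.le)
  · intro e z t h1 h2
    by_cases heS : e ∈ S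
    · have hwe : w' e = w e := by simp [hw', heS]
      rw [hwe] at h2
      obtain ⟨z', hz', hqz⟩ := hSD z
      have hX := hDpos.inv.posSemidef
      have key : ∀ a : p → ℝ, a ⬝ᵥ (z - z') = 0 → z ⬝ᵥ (Real.sqrt (w e) • a) = t →
          t ≤ 2 * (w e * (a ⬝ᵥ ((regDegree α β ε w)⁻¹ *ᵥ a))) := fun a ha hat => by
        rw [← quadForm_sqrt_smul (hw0 e)]
        exact leverage_le_of_relative_error hDpos hD₀ hη2 (hkerD _ hz')
          (by rw [smul_dotProduct, ha, smul_zero]) hqz h1 hat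
      have hsum := hdeg e
      rw [degreeLeverage, mul_add] at hsum
      have ha := mul_nonneg (hw0 e) (hX.dotProduct_mulVec_self_nonneg (α e))
      have hb := mul_nonneg (hw0 e) (hX.dotProduct_mulVec_self_nonneg (β e))
      rcases h2 with h2 | h2
      · linarith [key (α e) (hz' e heS).1 h2]
      · linarith [key (β e) (hz' e heS).2 h2]
    · have hwe : w' e = 0 := by simp [hw', heS]
      simp only [hwe, Real.sqrt_zero, zero_smul, dotProduct_zero, or_self] at h2
      linarith
  · intro e y z B ζ hζ hyz hB hBL hzB hzD
    by_cases heS : e ∈ S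
    · have hwe : w' e = w e := by simp [hw', heS]
      rw [hwe] at hB hzB
      obtain ⟨y', hy', hqy⟩ := hSL y
      obtain ⟨z', hz', hqz⟩ := hSD z
      have hfin := bottom_le_of_relative_error hDpos hLpos hD₀ hL₀ hDD hLL hLD hη0 hη2
        (hkerL _ hy') (hkerD _ hz') (b := Real.sqrt (w e) • (α - β) e)
        (by rw [smul_dotProduct, hy' e heS, smul_zero])
        (by rw [smul_dotProduct, Pi.sub_apply, sub_dotProduct, (hz' e heS).1, (hz' e heS).2,
          sub_zero, smul_zero]) hqy hqz hyz hζ hB hBL hzB hzD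
      have hres : Real.sqrt (w e) • (α - β) e - regLaplacian α β ε w *ᵥ
          ((regDegree α β ε w)⁻¹ *ᵥ (Real.sqrt (w e) • (α - β) e)) =
          Real.sqrt (w e) • edgeResidual α β ε w e := by
        rw [edgeResidual, Matrix.mulVec_smul, Matrix.mulVec_smul, smul_sub]
      rw [hres, quadForm_sqrt_smul (hw0 e), quadForm_sqrt_smul (hw0 e)] at hfin
      have h1 : w e * ((α - β) e ⬝ᵥ ((regDegree α β ε w)⁻¹ *ᵥ (α - β) e)) ≤ 2 * τ₁ :=
        calc _ ≤ w e * (2 * degreeLeverage α β ε w e) :=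
              mul_le_mul_of_nonneg_left (sub_form_le_two_mul_degreeLeverage α β hε hw0 e) (hw0 e)
          _ ≤ 2 * τ₁ := by linarith [hdeg e]
      have h2 : w e * (edgeResidual α β ε w e ⬝ᵥ
          ((regLaplacian α β ε w)⁻¹ *ᵥ edgeResidual α β ε w e)) ≤ τ₂ := hbot e
      have h3 := mul_le_mul_of_nonneg_left h1 (by positivity : 0 ≤ 48 * η)
      linarith
    · have hwe : w' e = 0 := by simp [hw', heS]
      simp only [hwe, Real.sqrt_zero, zero_smul, dotProduct_zero] at hB
      linarith

end

/-! ### Pseudoinverse square roots, the bottom spectral form and incidence vectors of a graph. -/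

noncomputable section

section FunctionalCalculus

variable {ι : Type*} [Fintype ι] [DecidableEq ι] {A : Matrix ι ι ℝ}

theorem Matrix.continuousOn_spectrum (A : Matrix ι ι ℝ) (f : ℝ → ℝ) :
    ContinuousOn f (spectrum ℝ A) := A.finite_real_spectrum.continuousOn f

theorem Matrix.cfc_mul_cfc (A : Matrix ι ι ℝ) (f g : ℝ → ℝ) :
    cfc f A * cfc g A = cfc (fun x => f x * g x) A :=
  (cfc_mul f g A (A.continuousOn_spectrum f) (A.continuousOn_spectrum g)).symm

theorem Matrix.IsHermitian.mul_cfc (hA : A.IsHermitian) (f : ℝ → ℝ) :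
    A * cfc f A = cfc (fun x => x * f x) A := by
  have h := A.cfc_mul_cfc (fun x => x) f
  rwa [cfc_id' ℝ A (show IsSelfAdjoint A from hA)] at h

theorem Matrix.cfc_transpose (A : Matrix ι ι ℝ) (f : ℝ → ℝ) : (cfc f A)ᵀ = cfc f A :=
  Matrix.IsHermitian.transpose_eq_self (cfc_predicate f A)

theorem Matrix.IsHermitian.symPinv_mul_mul_symPinv (hA : A.IsHermitian) :
    symPinv A * (A * symPinv A) = symPinv A := by
  rw [symPinv, hA.mul_cfc, Matrix.cfc_mul_cfc]
  congr 1
  funext x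
  by_cases hx : x = 0
  · simp [hx]
  · field_simp

theorem Matrix.IsHermitian.mul_symPinvSqrt (hA : A.IsHermitian) :
    A * symPinvSqrt A = cfc Real.sqrt A := by
  rw [symPinvSqrt, hA.mul_cfc]
  congr 1
  funext x
  rw [← div_eq_mul_inv, Real.div_sqrt]

theorem Matrix.cfc_sqrt_mul_symPinvSqrt_mul_symPinvSqrt (A : Matrix ι ι ℝ) :
    cfc Real.sqrt A * symPinvSqrt A * symPinvSqrt A = symPinvSqrt A := by
  rw [symPinvSqrt, Matrix.cfc_mul_cfc, Matrix.cfc_mul_cfc]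
  congr 1
  funext x
  by_cases hx : Real.sqrt x = 0
  · simp [hx]
  · field_simp

theorem Matrix.cfc_sqrt_mul_symPinvSqrt_comm (A : Matrix ι ι ℝ) :
    cfc Real.sqrt A * symPinvSqrt A = symPinvSqrt A * cfc Real.sqrt A := by
  rw [symPinvSqrt, Matrix.cfc_mul_cfc, Matrix.cfc_mul_cfc]
  simp only [mul_comm]

theorem Matrix.PosSemidef.mul_cfc_sqrt_mul_symPinvSqrt (hA : A.PosSemidef) :
    A * (cfc Real.sqrt A * symPinvSqrt A) = A := by
  have hA' : IsSelfAdjoint A := hA.isHermitian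
  rw [symPinvSqrt, Matrix.cfc_mul_cfc, hA.isHermitian.mul_cfc]
  nth_rewrite 2 [← cfc_id' ℝ A hA']
  refine cfc_congr fun x hx => ?_
  have hx0 : 0 ≤ x := by
    rw [hA.isHermitian.spectrum_real_eq_range_eigenvalues] at hx
    obtain ⟨i, rfl⟩ := hx
    exact hA.eigenvalues_nonneg i
  rcases hx0.eq_or_lt with h | h
  · simp [← h]
  · simp [(Real.sqrt_pos.2 h).ne']

/-- A matrix dominated by `D` is fixed by the projection to the range of `D`. -/
theorem Matrix.PosSemidef.projection_mul_eq {D L : Matrix ι ι ℝ} (hD : D.PosSemidef)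
    (hL : L.PosSemidef) (hLD : ((2 : ℝ) • D - L).PosSemidef) :
    cfc Real.sqrt D * symPinvSqrt D * L = L := by
  set P := cfc Real.sqrt D * symPinvSqrt D with hP
  have hPT : Pᵀ = P := by
    rw [hP, Matrix.transpose_mul, symPinvSqrt, Matrix.cfc_transpose, Matrix.cfc_transpose]
    exact (Matrix.cfc_sqrt_mul_symPinvSqrt_comm D).symm
  -- On the kernel of `D`, `L ≤ 2D` forces the form of `L` to vanish, hence `L` itself; and `1 - P`
  -- maps into that kernel.
  have hLP : L * (1 - P) = 0 := by
    refine Matrix.ext_of_mulVec_single fun i => ?_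
    rw [Matrix.zero_mulVec, ← Matrix.mulVec_mulVec]
    set x := (1 - P) *ᵥ Pi.single i 1 with hx
    have hDx : D *ᵥ x = 0 := by
      rw [hx, Matrix.mulVec_mulVec, Matrix.mul_sub, Matrix.mul_one,
        hD.mul_cfc_sqrt_mul_symPinvSqrt, sub_self, Matrix.zero_mulVec]
    have h1 := hLD.dotProduct_mulVec_self_nonneg x
    rw [Matrix.sub_mulVec, Matrix.smul_mulVec, hDx, smul_zero, zero_sub, dotProduct_neg] at h1
    have h2 := hL.dotProduct_mulVec_self_nonneg x
    have h3 := (hL.dotProduct_mulVec_zero_iff x).1 (by rw [star_trivial]; linarith)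
    exact h3
  have h := congrArg Matrix.transpose hLP
  rw [Matrix.transpose_mul, Matrix.transpose_sub, Matrix.transpose_one, hPT,
    hL.isHermitian.transpose_eq_self, Matrix.transpose_zero, Matrix.sub_mul, Matrix.one_mul,
    sub_eq_zero] at h
  exact h.symm

end FunctionalCalculus

namespace MatrixWeightedGraph

variable {V : Type*} {k : ℕ} [Fintype V] [DecidableEq V]

theorem eigenvectorBasis_dotProduct {ι : Type*} [Fintype ι] [DecidableEq ι] {A : Matrix ι ι ℝ}
    (hA : A.IsHermitian) (i j : ι) :
    (hA.eigenvectorBasis i).ofLp ⬝ᵥ (hA.eigenvectorBasis j).ofLp = if i = j then 1 else 0 := by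
  have h := orthonormal_iff_ite.1 hA.eigenvectorBasis.orthonormal i j
  rw [EuclideanSpace.inner_eq_star_dotProduct, star_trivial, dotProduct_comm] at h
  exact h

/-- The bottom form of a vector, represented by a pair of vectors `y`, `z` with `L y = D z`. -/
theorem exists_bottomInv_representation (H : MatrixWeightedGraph V k) (hD : H.degreeMatrix.PosSemidef)
    (hL : H.laplacian.PosSemidef) (hLD : ((2 : ℝ) • H.degreeMatrix - H.laplacian).PosSemidef)
    (ζ : ℝ) (b : Fin k × V → ℝ) : ∃ (y z : Fin k × V → ℝ) (B : ℝ),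
      B = (symPinvSqrt H.degreeMatrix *ᵥ b) ⬝ᵥ
        (H.bottomInv ζ *ᵥ (symPinvSqrt H.degreeMatrix *ᵥ b)) ∧
      H.laplacian *ᵥ y = H.degreeMatrix *ᵥ z ∧ y ⬝ᵥ b = B ∧ y ⬝ᵥ (H.laplacian *ᵥ y) = B ∧
      z ⬝ᵥ b ≤ ζ * B ∧ z ⬝ᵥ (H.degreeMatrix *ᵥ z) ≤ ζ * B := by
  set D := H.degreeMatrix with hDdef
  set L := H.laplacian with hLdef
  set Q := symPinvSqrt D with hQ
  set R := cfc Real.sqrt D with hR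
  set x := Q *ᵥ b with hx
  set hN := H.normLaplacian_isHermitian
  set f : Fin k × V → Fin k × V → ℝ := fun i => (hN.eigenvectorBasis i).ofLp with hf
  set l := hN.eigenvalues with hl
  set S := Finset.univ.filter fun i => l i ∈ Set.Ioc 0 ζ with hS
  have hl0 : ∀ i ∈ S, 0 < l i := fun i hi => (Finset.mem_filter.1 hi).2.1
  have hlζ : ∀ i ∈ S, l i ≤ ζ := fun i hi => (Finset.mem_filter.1 hi).2.2
  have hNf : ∀ i, (Q * L * Q) *ᵥ f i = l i • f i := fun i => hN.mulVec_eigenvectorBasis i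
  have hff : ∀ i j, f i ⬝ᵥ f j = if i = j then 1 else 0 := eigenvectorBasis_dotProduct hN
  -- `F` is the bottom inverse applied to `x`, and `T = N F` is the projection of `x` to the bottom
  -- eigenspaces. The witnesses are `y = D^{†/2} F` and `z = D^{†/2} T`; `λᵢ ≤ ζ` gives `‖T‖² ≤ ζ
  -- B`.
  set F := ∑ i ∈ S, ((f i ⬝ᵥ x) / l i) • f i with hF
  set T := ∑ i ∈ S, (f i ⬝ᵥ x) • f i with hT
  have hNF : (Q * L * Q) *ᵥ F = T := by
    rw [hF, Matrix.mulVec_sum]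
    refine Finset.sum_congr rfl fun i hi => ?_
    rw [Matrix.mulVec_smul, hNf, smul_smul, div_mul_cancel₀ _ (hl0 i hi).ne']
  have hQT : Qᵀ = Q := Matrix.cfc_transpose D _
  have hQs : ∀ u v, (Q *ᵥ u) ⬝ᵥ v = u ⬝ᵥ (Q *ᵥ v) := fun u v => by
    rw [Matrix.dotProduct_mulVec, ← Matrix.mulVec_transpose, hQT]
  have hDQ : D * Q = R := hD.isHermitian.mul_symPinvSqrt
  have hRQ : R * Q = Q * R := Matrix.cfc_sqrt_mul_symPinvSqrt_comm D
  have hRQQ : R * Q * Q = Q := Matrix.cfc_sqrt_mul_symPinvSqrt_mul_symPinvSqrt D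
  have hPL : R * Q * L = L := hD.projection_mul_eq hL hLD
  have hPT : (R * Q) *ᵥ T = T := by
    rw [← hNF, Matrix.mulVec_mulVec, ← Matrix.mul_assoc, ← Matrix.mul_assoc, hRQQ]
  have hFT : F ⬝ᵥ T = ∑ i ∈ S, (f i ⬝ᵥ x) ^ 2 / l i := by
    rw [hF, hT, sum_dotProduct]
    refine Finset.sum_congr rfl fun i hi => ?_
    simp only [smul_dotProduct, dotProduct_sum, dotProduct_smul, hff, smul_eq_mul, mul_ite, mul_one,
      mul_zero, Finset.sum_ite_eq, hi, if_true]
    ring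
  have hTT : T ⬝ᵥ T = ∑ i ∈ S, (f i ⬝ᵥ x) ^ 2 := by
    nth_rewrite 1 [hT]
    rw [hT, sum_dotProduct]
    refine Finset.sum_congr rfl fun i hi => ?_
    simp only [smul_dotProduct, dotProduct_sum, dotProduct_smul, hff, smul_eq_mul, mul_ite, mul_one,
      mul_zero, Finset.sum_ite_eq, hi, if_true]
    ring
  have hFx : F ⬝ᵥ x = ∑ i ∈ S, (f i ⬝ᵥ x) ^ 2 / l i := by
    rw [hF, sum_dotProduct]
    refine Finset.sum_congr rfl fun i hi => ?_
    rw [smul_dotProduct, smul_eq_mul]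
    ring
  have hTx : T ⬝ᵥ x = ∑ i ∈ S, (f i ⬝ᵥ x) ^ 2 := by
    rw [hT, sum_dotProduct]
    refine Finset.sum_congr rfl fun i hi => ?_
    rw [smul_dotProduct, smul_eq_mul, sq]
  have hle : ∑ i ∈ S, (f i ⬝ᵥ x) ^ 2 ≤ ζ * ∑ i ∈ S, (f i ⬝ᵥ x) ^ 2 / l i := by
    rw [Finset.mul_sum]
    refine Finset.sum_le_sum fun i hi => ?_
    rw [← mul_div_assoc, le_div_iff₀ (hl0 i hi), mul_comm]
    exact mul_le_mul_of_nonneg_right (hlζ i hi) (sq_nonneg _)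
  refine ⟨Q *ᵥ F, Q *ᵥ T, ∑ i ∈ S, (f i ⬝ᵥ x) ^ 2 / l i, ?_, ?_, ?_, ?_, ?_, ?_⟩
  · rw [bottomInv, Matrix.sum_mulVec, dotProduct_sum]
    refine Finset.sum_congr rfl fun i _ => ?_
    rw [Matrix.smul_mulVec, dotProduct_smul, Matrix.vecMulVec_mulVec, op_smul_eq_smul,
      dotProduct_smul, smul_eq_mul, smul_eq_mul, dotProduct_comm x]
    change _ = 1 / l i * ((f i ⬝ᵥ x) * (f i ⬝ᵥ x))
    ring
  · have h : D *ᵥ (Q *ᵥ T) = R *ᵥ T := by rw [Matrix.mulVec_mulVec, hDQ]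
    rw [h, ← hNF, Matrix.mulVec_mulVec, Matrix.mulVec_mulVec, ← Matrix.mul_assoc,
      ← Matrix.mul_assoc, hPL]
  · rw [hQs, ← hx, hFx]
  · rw [hQs, Matrix.mulVec_mulVec, Matrix.mulVec_mulVec, hNF, hFT]
  · rw [hQs, ← hx, hTx]
    exact hle
  · rw [hQs, Matrix.mulVec_mulVec, Matrix.mulVec_mulVec, Matrix.mul_assoc, hDQ, ← hRQ, hPT, hTT]
    exact hle

/-! ### The incidence family of a matrix-weighted graph -/

/-- An end of an edge. -/
def edgeHead (G : SimpleGraph V) (e : G.edgeSet) : V := (Quot.out e.1).1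

/-- The other end of an edge. -/
def edgeTail (G : SimpleGraph V) (e : G.edgeSet) : V := (Quot.out e.1).2

theorem mk_edgeHead_edgeTail (G : SimpleGraph V) (e : G.edgeSet) :
    s(edgeHead G e, edgeTail G e) = e.1 := Quot.out_eq e.1

/-- The block vector with a given block at the vertex `u`. -/
def blockVec (x : Fin k → ℝ) (u : V) : Fin k × V → ℝ := fun p => if p.2 = u then x p.1 else 0

theorem blockVec_dotProduct (x : Fin k → ℝ) (u : V) (y : Fin k × V → ℝ) :
    blockVec x u ⬝ᵥ y = x ⬝ᵥ fun i => y (i, u) := by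
  simp only [dotProduct, blockVec, Fintype.sum_prod_type, ite_mul, zero_mul, Finset.sum_ite_eq',
    Finset.mem_univ, if_true]

theorem blockDiagonal_mulVec_blockVec (M : V → Matrix (Fin k) (Fin k) ℝ) (x : Fin k → ℝ) (u : V) :
    (fun i => (Matrix.blockDiagonal M *ᵥ blockVec x u) (i, u)) = M u *ᵥ x := by
  funext i
  simp only [Matrix.mulVec, dotProduct, blockVec, Fintype.sum_prod_type, Matrix.blockDiagonal_apply,
    mul_ite, ite_mul, zero_mul, mul_zero, Finset.sum_ite_eq', Finset.mem_univ, if_true]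

variable (H : MatrixWeightedGraph V k)

/-- The block of the incidence vectors at the first ends of the edges. -/
def headVec (e : H.graph.edgeSet) : Fin k × V → ℝ := blockVec (H.φ e) (edgeHead H.graph e)

/-- The block of the incidence vectors at the second ends of the edges, with the opposite sign. -/
def tailVec (e : H.graph.edgeSet) : Fin k × V → ℝ := blockVec (H.φ e) (edgeTail H.graph e)

theorem isIncidenceFamily : IsIncidenceFamily Prod.snd (edgeHead H.graph) (edgeTail H.graph)
    H.headVec H.tailVec where
  support_left e i h := by
    by_contra hn
    exact h (by simp [headVec, blockVec, hn])
  support_right e i h := by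
    by_contra hn
    exact h (by simp [tailVec, blockVec, hn])
  loopless e := by
    have h := e.2
    rw [← mk_edgeHead_edgeTail, SimpleGraph.mem_edgeSet] at h
    exact h.ne
  simple := by
    intro e e' h
    simp only [mk_edgeHead_edgeTail] at h
    exact Subtype.ext h

theorem incVec_eq (e : H.graph.edgeSet) :
    H.incVec (edgeHead H.graph e) (edgeTail H.graph e) = (H.headVec - H.tailVec) e := by
  funext p
  simp only [incVec, Pi.sub_apply, headVec, tailVec, blockVec, mk_edgeHead_edgeTail]
  split_ifs <;> ring

theorem rescale_incVec (s : Sym2 V → ℝ) (u v : V) :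
    (H.rescale s).incVec u v = s s(u, v) • H.incVec u v := by
  funext p
  simp only [incVec, rescale, Pi.smul_apply, smul_eq_mul]
  ring

variable [Fintype H.graph.edgeSet] {s : Sym2 V → ℝ} {w : H.graph.edgeSet → ℝ}

theorem rescale_laplacian (hs : ∀ e : H.graph.edgeSet, s e * s e = w e) :
    (H.rescale s).laplacian = weightedGram w (H.headVec - H.tailVec) := by
  classical
  rw [laplacian, weightedGram]
  have h : (Finset.univ.filter fun e : Sym2 V => e ∈ (H.rescale s).graph.edgeSet) =
      (Finset.univ : Finset H.graph.edgeSet).map (Function.Embedding.subtype _) := by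
    ext e
    simp only [Finset.mem_filter, Finset.mem_univ, true_and, Finset.mem_map,
      Function.Embedding.coe_subtype, Subtype.exists, exists_prop, exists_eq_right]
    rfl
  rw [h, Finset.sum_map]
  refine Finset.sum_congr rfl fun e _ => ?_
  rw [Function.Embedding.coe_subtype, ← hs e, ← incVec_eq]
  conv_lhs => rw [← mk_edgeHead_edgeTail]
  change Matrix.vecMulVec ((H.rescale s).incVec _ _) ((H.rescale s).incVec _ _) = _
  rw [rescale_incVec, mk_edgeHead_edgeTail, Matrix.smul_vecMulVec, Matrix.vecMulVec_smul, smul_smul]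

/-- Each edge at a vertex has it as exactly one of its two chosen ends, so the head and tail sums
together run once over the neighbours. -/
theorem rescale_degreeMatrix (hs : ∀ e : H.graph.edgeSet, s e * s e = w e) :
    (H.rescale s).degreeMatrix = weightedGram w H.headVec + weightedGram w H.tailVec := by
  classical
  ext ⟨i, a⟩ ⟨j, b⟩
  simp only [degreeMatrix, Matrix.blockDiagonal_apply, weightedGram, Matrix.add_apply,
    Matrix.sum_apply, Matrix.smul_apply, Matrix.vecMulVec_apply, headVec, tailVec, blockVec,
    smul_eq_mul, ← Finset.sum_add_distrib]
  by_cases hab : a = b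
  · subst hab
    rw [if_pos rfl, vertexDegree, Matrix.sum_apply]
    have hR : ∀ e : H.graph.edgeSet, (w e * ((if a = edgeHead H.graph e then H.φ e i else 0) *
        if a = edgeHead H.graph e then H.φ e j else 0) +
        w e * ((if a = edgeTail H.graph e then H.φ e i else 0) *
        if a = edgeTail H.graph e then H.φ e j else 0)) =
        if a ∈ e.1 then w e * (H.φ e i * H.φ e j) else 0 := by
      intro e
      have hne := H.isIncidenceFamily.loopless e
      have hmem : a ∈ e.1 ↔ a = edgeHead H.graph e ∨ a = edgeTail H.graph e := by
        rw [← mk_edgeHead_edgeTail, Sym2.mem_iff]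
      by_cases h1 : a = edgeHead H.graph e
      · have h2 : ¬ a = edgeTail H.graph e := fun h2 => hne (h1 ▸ h2)
        rw [if_pos (hmem.2 (Or.inl h1))]
        simp only [if_pos h1, if_neg h2]
        ring
      · by_cases h2 : a = edgeTail H.graph e
        · rw [if_pos (hmem.2 (Or.inr h2))]
          simp only [if_neg h1, if_pos h2]
          ring
        · rw [if_neg fun h => (hmem.1 h).elim h1 h2]
          simp only [if_neg h1, if_neg h2]
          ring
    rw [Finset.sum_congr rfl fun e _ => hR e, ← Finset.sum_filter]
    refine Finset.sum_bij (fun v hv => ⟨s(a, v), (Finset.mem_filter.1 hv).2⟩) ?_ ?_ ?_ ?_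
    · intro v hv
      simp
    · intro v _ v' _ hvv
      exact Sym2.congr_right.1 (congrArg Subtype.val hvv)
    · rintro ⟨e, he⟩ hae
      obtain ⟨v, rfl⟩ := (Finset.mem_filter.1 hae).2
      exact ⟨v, Finset.mem_filter.2 ⟨Finset.mem_univ v, he⟩, rfl⟩
    · intro v hv
      rw [← hs]
      simp only [rescale, Matrix.vecMulVec_apply, Pi.smul_apply, smul_eq_mul]
      ring
  · rw [if_neg hab, eq_comm]
    refine Finset.sum_eq_zero fun e _ => ?_
    have h1 : ¬(a = edgeHead H.graph e ∧ b = edgeHead H.graph e) := fun h => hab (h.1.trans h.2.symm)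
    have h2 : ¬(a = edgeTail H.graph e ∧ b = edgeTail H.graph e) := fun h => hab (h.1.trans h.2.symm)
    simp only [ite_mul, mul_ite, zero_mul, mul_zero]
    split_ifs <;> first | tauto | simp

end MatrixWeightedGraph

end

/-! ### The scaling of a graph and the choice of thresholds. -/

noncomputable section

namespace MatrixWeightedGraph

variable {V : Type*} {k : ℕ} [Fintype V] [DecidableEq V]

theorem exists_scaling (H : MatrixWeightedGraph V k) {τ₁ τ₂ ζ : ℝ} (hτ₁ : 0 < τ₁) (hτ₂ : 0 < τ₂)
    (hζ : ζ ≤ 1 / 4) : ∃ s : Sym2 V → ℝ, (∀ e, s e ∈ Set.Icc (0 : ℝ) 1) ∧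
      (∀ u v, H.graph.Adj u v → (H.rescale s).φ s(u, v) ⬝ᵥ
        (symPinv ((H.rescale s).vertexDegree u) *ᵥ (H.rescale s).φ s(u, v)) ≤ 2 * τ₁) ∧
      (∀ u v, H.graph.Adj u v →
        (symPinvSqrt (H.rescale s).degreeMatrix *ᵥ (H.rescale s).incVec u v) ⬝ᵥ
          ((H.rescale s).bottomInv ζ *ᵥ
            (symPinvSqrt (H.rescale s).degreeMatrix *ᵥ (H.rescale s).incVec u v)) ≤ 8 * τ₂) ∧
      (({e ∈ H.graph.edgeSet | s e < 1}.ncard : ℕ) : ℝ) ≤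
        Fintype.card (Fin k × V) / τ₁ + τ₁ * Fintype.card (Fin k × V) / τ₂ := by
  classical
  obtain ⟨w, hw, hcard, hreg, hexp⟩ := H.isIncidenceFamily.exists_weights hτ₁ hτ₂
  -- The matrix weight of an edge scales by `s²`, hence the square root.
  set s : Sym2 V → ℝ := fun e => if h : e ∈ H.graph.edgeSet then Real.sqrt (w ⟨e, h⟩) else 1
    with hs
  have hse : ∀ e : H.graph.edgeSet, s e = Real.sqrt (w e) := fun e => by simp [hs]
  have hsq : ∀ e : H.graph.edgeSet, s e * s e = w e := fun e => by
    rw [hse, Real.mul_self_sqrt (hw e).1]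
  have hD := H.rescale_degreeMatrix hsq
  have hL := H.rescale_laplacian hsq
  have hw0 : ∀ e, 0 ≤ w e := fun e => (hw e).1
  refine ⟨s, fun e => ?_, ?_, ?_, ?_⟩
  · simp only [hs]
    split_ifs with h
    · exact ⟨Real.sqrt_nonneg _, Real.sqrt_le_one.2 (hw _).2⟩
    · exact ⟨zero_le_one, le_rfl⟩
  · intro u v huv
    set e : H.graph.edgeSet := ⟨s(u, v), huv⟩ with he
    set M := (H.rescale s).vertexDegree u with hM
    have hMh : M.IsHermitian := isSelfAdjoint_sum _ fun v _ => by
      ext i j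
      simp [Matrix.vecMulVec_apply, mul_comm]
    set x := (H.rescale s).φ s(u, v) with hx
    have hxe : x = Real.sqrt (w e) • H.φ e := by rw [← hse]; rfl
    -- The block `D_u† φ` placed at `u`: its degree form and its pairing with the end of the edge at
    -- `u` both equal the leverage.
    set z := blockVec (symPinv M *ᵥ x) u with hz
    have hPT : (symPinv M)ᵀ = symPinv M := Matrix.cfc_transpose _ _
    have hsym : ∀ a b, (symPinv M *ᵥ a) ⬝ᵥ b = a ⬝ᵥ (symPinv M *ᵥ b) := fun a b => by
      rw [Matrix.dotProduct_mulVec, ← Matrix.mulVec_transpose, hPT]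
    refine hreg e z _ ?_ ?_
    · rw [← hD, hz, blockVec_dotProduct, degreeMatrix, blockDiagonal_mulVec_blockVec, ← hM, hsym,
        Matrix.mulVec_mulVec, Matrix.mulVec_mulVec, Matrix.mul_assoc, hMh.symPinv_mul_mul_symPinv]
    · have hmem : u = edgeHead H.graph e ∨ u = edgeTail H.graph e := by
        rw [← Sym2.mem_iff, mk_edgeHead_edgeTail]
        exact Sym2.mem_mk_left u v
      have hval : ∀ a : V, u = a → z ⬝ᵥ (Real.sqrt (w e) • blockVec (H.φ e) a) =
          x ⬝ᵥ (symPinv M *ᵥ x) := by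
        rintro a rfl
        rw [hz, blockVec_dotProduct, dotProduct_comm]
        congr 1
        funext i
        simp [hxe, blockVec]
      exact hmem.imp (hval _) (hval _)
  · intro u v huv
    set e : H.graph.edgeSet := ⟨s(u, v), huv⟩ with he
    have hmain : (symPinvSqrt (H.rescale s).degreeMatrix *ᵥ
        (Real.sqrt (w e) • (H.headVec - H.tailVec) e)) ⬝ᵥ ((H.rescale s).bottomInv ζ *ᵥ
          (symPinvSqrt (H.rescale s).degreeMatrix *ᵥ
            (Real.sqrt (w e) • (H.headVec - H.tailVec) e))) ≤ 8 * τ₂ := by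
      obtain ⟨y, z, B, hB, h1, h2, h3, h4, h5⟩ :=
        (H.rescale s).exists_bottomInv_representation
          (by rw [hD]; exact (weightedGram_posSemidef hw0 _).add (weightedGram_posSemidef hw0 _))
          (by rw [hL]; exact weightedGram_posSemidef hw0 _)
          (by
            have h := two_smul_regDegree_sub_regLaplacian H.headVec H.tailVec 0 w
            rw [regDegree, regLaplacian, zero_smul, add_zero, add_zero, add_zero] at h
            rw [hD, hL, h]
            exact weightedGram_posSemidef hw0 _) ζ (Real.sqrt (w e) • (H.headVec - H.tailVec) e)
      rw [← hB]
      rw [hL, hD] at h1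
      rw [hL] at h3
      rw [hD] at h5
      exact hexp e y z B ζ hζ h1 h2 h3 h4 h5
    have hends : (u = edgeHead H.graph e ∧ v = edgeTail H.graph e) ∨
        (u = edgeTail H.graph e ∧ v = edgeHead H.graph e) := by
      rw [← Sym2.eq_iff, mk_edgeHead_edgeTail]
    have hb : (H.rescale s).incVec (edgeHead H.graph e) (edgeTail H.graph e) =
        Real.sqrt (w e) • (H.headVec - H.tailVec) e := by
      rw [rescale_incVec, mk_edgeHead_edgeTail, hse, incVec_eq]
    rcases hends with ⟨hu, hv⟩ | ⟨hu, hv⟩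
    · rw [hu, hv, hb]; exact hmain
    · rw [hu, hv, incVec_swap, hb, Matrix.mulVec_neg, Matrix.mulVec_neg, neg_dotProduct_neg]
      exact hmain
  · refine le_trans ?_ hcard
    have hsub : {e ∈ H.graph.edgeSet | s e < 1} ⊆
        Subtype.val '' (↑(Finset.univ.filter fun e : H.graph.edgeSet => w e < 1) :
          Set H.graph.edgeSet) := by
      rintro e ⟨he, hlt⟩
      refine ⟨⟨e, he⟩, ?_, rfl⟩
      have h := hse ⟨e, he⟩
      simp only at h
      rw [h, Real.sqrt_lt' one_pos, one_pow] at hlt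
      simpa using hlt
    have h1 := (Set.ncard_le_ncard hsub (Set.toFinite _)).trans (Set.ncard_image_le (Set.toFinite _))
    rw [Set.ncard_coe_finset] at h1
    exact_mod_cast h1

theorem ncard_edgeSet_le (G : SimpleGraph V) : (G.edgeSet.ncard : ℝ) ≤ (Fintype.card V : ℝ) ^ 2 := by
  have h1 : G.edgeSet.ncard ≤ Nat.card (Sym2 V) := by
    rw [← Set.ncard_univ]
    exact Set.ncard_le_ncard (Set.subset_univ _) (Set.toFinite _)
  have h2 : Nat.card (Sym2 V) ≤ Nat.card (V × V) :=
    Nat.card_le_card_of_surjective _ Sym2.mk_surjective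
  have h3 := h1.trans h2
  rw [Nat.card_prod, Nat.card_eq_fintype_card, ← sq] at h3
  exact_mod_cast h3

theorem rescale_zero_isAlmostRegularExpander (H : MatrixWeightedGraph V k) {γ ζ ψ : ℝ}
    (hγ : 0 ≤ γ) (hψ : 0 ≤ ψ) :
    (H.rescale fun _ => 0).IsAlmostRegularExpander γ ζ ψ := by
  refine ⟨fun u v _ => ?_, fun u v _ => ?_⟩
  · have : (H.rescale fun _ => 0).φ s(u, v) = 0 := by simp [rescale]
    rw [this, zero_dotProduct]
    positivity
  · rw [rescale_incVec, zero_smul, Matrix.mulVec_zero, zero_dotProduct]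
    positivity

theorem isAlmostRegularExpander_of_dim_zero (H : MatrixWeightedGraph V 0) (γ ζ ψ : ℝ) :
    H.IsAlmostRegularExpander γ ζ ψ :=
  ⟨fun u v _ => by simp [dotProduct], fun u v _ => by simp [dotProduct]⟩

end MatrixWeightedGraph

/-- The bound on the number of rescaled edges. -/
def rescaledEdgeBound (n : ℕ) : ℝ :=
  if Real.log n < 4 then (n : ℝ) ^ 2 else (n : ℝ) ^ 2 / Real.log n

theorem rescaledEdgeBound_nonneg (n : ℕ) : 0 ≤ rescaledEdgeBound n := by
  unfold rescaledEdgeBound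
  have := Real.log_natCast_nonneg n
  split_ifs <;> positivity

theorem rescaledEdgeBound_isLittleO :
    rescaledEdgeBound =o[atTop] fun n : ℕ => (n : ℝ) ^ 2 := by
  have hlog : Tendsto (fun n : ℕ => Real.log n) atTop atTop :=
    Real.tendsto_log_atTop.comp tendsto_natCast_atTop_atTop
  have h : (fun n : ℕ => (n : ℝ) ^ 2 * (Real.log n)⁻¹) =o[atTop] fun n : ℕ => (n : ℝ) ^ 2 := by
    have h1 : (fun n : ℕ => (Real.log n)⁻¹) =o[atTop] fun _ : ℕ => (1 : ℝ) :=
      (isLittleO_one_iff ℝ).2 hlog.inv_tendsto_atTop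
    simpa using (isBigO_refl (fun n : ℕ => (n : ℝ) ^ 2) atTop).mul_isLittleO h1
  refine h.congr' ?_ EventuallyEq.rfl
  filter_upwards [hlog.eventually_ge_atTop 4] with n hn
  rw [rescaledEdgeBound, if_neg (not_lt.2 hn), div_eq_mul_inv]

theorem threshold_sum_le {n k l : ℝ} (hn : 0 < n) (hk : 1 ≤ k) (hl : 4 ≤ l) :
    k * n / (4 * l * k / n) + 4 * l * k / n * (k * n) / (2 * k ^ 4 * l ^ 3 / n ^ 2) ≤
      n ^ 2 / l := by
  have hl0 : 0 < l := by linarith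
  have hk0 : 0 < k := by linarith
  have h1 : k * n / (4 * l * k / n) = n ^ 2 / l * (1 / 4) := by
    field_simp
  have h2 : 4 * l * k / n * (k * n) / (2 * k ^ 4 * l ^ 3 / n ^ 2) =
      n ^ 2 / l * (2 / (k ^ 2 * l)) := by
    field_simp
    ring
  have h3 : 2 / (k ^ 2 * l) ≤ 1 / 2 := by
    rw [div_le_div_iff₀ (by positivity) (by norm_num)]
    nlinarith [one_le_pow₀ hk (n := 2)]
  have h4 : 0 ≤ n ^ 2 / l := by positivity
  rw [h1, h2]
  nlinarith

/-- Almost regular expander decomposition of dense matrix-weighted graphs. The bound `f` on the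
number of rescaled edges depends on the number of vertices and on the density `c` only. -/
theorem mainTheorem9 :
    ∀ c : ℝ, 0 < c →
      ∃ f : ℕ → ℝ, (f =o[atTop] fun n : ℕ => (n : ℝ) ^ 2) ∧
        ∀ (V : Type*) [Fintype V] [DecidableEq V] (n k : ℕ) (H : MatrixWeightedGraph V k),
          Fintype.card V = n →
          c * (n : ℝ) ^ 2 ≤ (H.graph.edgeSet.ncard : ℝ) →
          ∃ s : Sym2 V → ℝ,
            (∀ e ∈ H.graph.edgeSet, s e ∈ Set.Icc (0 : ℝ) 1) ∧
            (H.rescale s).IsAlmostRegularExpander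
              (8 * Real.log n) (1 / Real.log n) (16 * (k : ℝ) ^ 2 * Real.log n ^ 3) ∧
            (({e ∈ H.graph.edgeSet | s e < 1}.ncard : ℕ) : ℝ) ≤ f n := by
  intro c _
  refine ⟨rescaledEdgeBound, rescaledEdgeBound_isLittleO, fun V _ _ n k H hn _ => ?_⟩
  have hlog0 := Real.log_natCast_nonneg n
  -- Here `1 / log n` may exceed `1/4`, outside the range of the spectral comparison. Only boundedly
  -- many `n` are concerned, so every edge may be scaled to `0`.
  by_cases hlog : Real.log n < 4
  · refine ⟨fun _ => 0, fun e _ => ⟨le_rfl, zero_le_one⟩,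
      H.rescale_zero_isAlmostRegularExpander (by positivity) (by positivity), ?_⟩
    rw [rescaledEdgeBound, if_pos hlog, ← hn]
    refine le_trans ?_ (MatrixWeightedGraph.ncard_edgeSet_le H.graph)
    exact_mod_cast Set.ncard_le_ncard (Set.sep_subset _ _) (Set.toFinite _)
  rcases Nat.eq_zero_or_pos k with rfl | hk
  · refine ⟨fun _ => 1, fun e _ => ⟨zero_le_one, le_rfl⟩,
      MatrixWeightedGraph.isAlmostRegularExpander_of_dim_zero _ _ _ _, ?_⟩
    simpa using rescaledEdgeBound_nonneg n
  have hlog4 : 4 ≤ Real.log n := not_lt.1 hlog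
  have hn0 : (0 : ℝ) < n := by
    refine Nat.cast_pos.2 (Nat.pos_of_ne_zero fun h => ?_)
    rw [h] at hlog4
    norm_num at hlog4
  have hk1 : (1 : ℝ) ≤ k := by exact_mod_cast hk
  have hk0 : (0 : ℝ) < k := by linarith
  have hl0 : 0 < Real.log n := by linarith
  -- The thresholds are forced by `2τ₁ = γk/n` and `8τ₂ = ψk²/n²`.
  obtain ⟨s, hs, hreg, hexp, hcount⟩ := H.exists_scaling
    (τ₁ := 4 * Real.log n * k / n) (τ₂ := 2 * (k : ℝ) ^ 4 * Real.log n ^ 3 / (n : ℝ) ^ 2)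
    (ζ := 1 / Real.log n) (by positivity) (by positivity)
    (one_div_le_one_div_of_le (by norm_num) hlog4)
  refine ⟨s, fun e _ => hs e, ⟨fun u v huv => ?_, fun u v huv => ?_⟩, ?_⟩
  · refine (hreg u v huv).trans_eq ?_
    rw [hn]
    ring
  · refine (hexp u v huv).trans_eq ?_
    rw [hn]
    ring
  · refine hcount.trans ?_
    rw [rescaledEdgeBound, if_neg hlog, Fintype.card_prod, Fintype.card_fin, hn, Nat.cast_mul]
    exact threshold_sum_le hn0 hk1 hlog4

end
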